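/- Let $N\ge 1$ and let $g>0$ be the gravitational constant. For functions $\varphi_1,\dots,\varphi_N$ on $[0,1]$ put $$M_{ij}=\int_0^1\varphi_i\varphi_j,\qquad A_{ijk}=\int_0^1\varphi_i\varphi_j\varphi_k,\qquad B_{ijk}=\int_0^1\varphi_i'(\zeta)\Big(\int_0^\zeta\varphi_j(\hat\zeta)\,d\hat\zeta\Big)\varphi_k(\zeta)\,d\zeta .$$ For water height $h$, mean velocity $u$ and coefficients $s\in\mathbb R^N$ (velocity profile $u+\sum_i s_i\varphi_i$), the frictionless, flat-bottom moment system with basis $\varphi$ is $$\operatorname{diag}(1,1,M)\,\partial_tU+A(h,u,s)\,\partial_xU=0,\qquad U=(h,hu,hs_1,\dots,hs_N)^T,$$ where, for $1\le i,l\le N$, $$A=\begin{pmatrix}0&1&0\\ -u^2+gh-\sum_{j,k}M_{jk}s_js_k&2u&\big(2\sum_jM_{lj}s_j\big)_{l}\\ \big(-2u\sum_jM_{ij}s_j-\sum_{j,k}A_{ijk}s_js_k\big)_i&\big(2\sum_jM_{ij}s_j\big)_i&\big(\sum_j(B_{ilj}+2A_{ijl})s_j+uM_{il}\big)_{i,l}\end{pmatrix}.$$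 Its system matrix is $A_{sys}=\operatorname{diag}(1,1,M)^{-1}A$. It is called SWME, with superscript $L$, for the Legendre basis $\varphi^{Leg}_i$ ($i=1,\dots,N$), the shifted Legendre polynomial of degree $i$ on $[0,1]$ with $\varphi^{Leg}_i(0)=1$. It is called SSWME, with superscript $S$, for a spline basis. A real square matrix is called hyperbolic if it is diagonalizable over $\mathbb R$. By a zero-mean spline basis of degree $N$ without interior knots we mean $N$ linearly independent splines $\varphi^S_1,\dots,\varphi^S_N$ of degree $N$ on the grid $\{0,1\}$ with $\int_0^1\varphi_i^S=0$. (1) Let $\tau_0\le\dots\le\tau_N=0<1=\tau_{N+1}\le\dots\le\tau_{2N+1}$ be knots, let $b_0,\dots,b_N$ be the B-splines of degree $N$ for these knots, and let $\mu_i=-\int_0^1b_i/\int_0^1b_{i+1}$. Then the constrained splines $b_i+\mu_ib_{i+1}$, $0\le i<N$, and any non-zero multiples of them, form a zero-mean spline basis of degree $N$ without interior knots (the hierarchy L1, Q2, …). (2) Let $\varphi^S$ be any zero-mean spline basis of degree $N$ without interior knots, let $M^{LS}_{ij}=\int_0^1\varphi^{Leg}_i\varphi^S_j$, $T=M^{LS}(M^S)^{-1}$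 and $\Lambda=\operatorname{diag}(1,1,T^T)$. Then: (a) $M^S$, $M^L$ and $T$ are invertible, and $\varphi^{Leg}_i=\sum_lT_{il}\varphi^S_l$ on $[0,1]$ for all $i$. (b) The SSWME is a linear change of variables of the SWME: $A^S_{sys}(h,u,s)=\Lambda\,A^L_{sys}(h,u,T^{-T}s)\,\Lambda^{-1}$ for all $h,u,s$. On every open set of the $(t,x)$-plane, $(h,u,s)$ is a differentiable solution with $h>0$ of the SSWME if and only if $(h,u,T^{-T}s)$ is one of the SWME. (c) For $\alpha_1\in\mathbb R$ the coefficients $\tilde s_i=T_{1i}\alpha_1$ satisfy $T^{-T}\tilde s=(\alpha_1,0,\dots,0)$ and $\sum_i\tilde s_i\varphi^S_i(\zeta)=\alpha_1(1-2\zeta)$ on $[0,1]$, so they correspond to a linear velocity profile. (d) Let the HSSWME be the system $\partial_tU+A^S_{sys}(h,u,\tilde s)\,\partial_xU=0$ with $\tilde s_i=T_{1i}\alpha_1$, $\alpha_1=(T^{-T}s)_1$, and let the HSWME be the system with Legendre coefficients $\alpha$ and matrix $A^L_{sys}(h,u,(\alpha_1,0,\dots,0))$. Then, for all $h,u,s$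 and $\alpha_1=(T^{-T}s)_1$, $$A^S_{sys}(h,u,\tilde s)=\Lambda\,A^L_{sys}\big(h,u,(\alpha_1,0,\dots,0)\big)\,\Lambda^{-1}.$$ On every open set, $(h,u,s)$ is a differentiable solution with $h>0$ of the HSSWME if and only if $(h,u,T^{-T}s)$ is one of the HSWME. (e) The HSWME and the HSSWME are globally hyperbolic: for all $h>0$, $u\in\mathbb R$ and all $\alpha$, respectively $s$, in $\mathbb R^N$ their system matrices are hyperbolic. -/

import Mathlib

open Set Matrix MeasureTheory
open scoped Polynomial

noncomputable section

namespace SSWME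

/-! ### Splines -/

/-- `IsSpline K G f`: on `[0,1]` the function `f` is a spline of degree `K ≥ 1` on the grid `G`:
it is a polynomial of degree at most `K` on every closed interval without grid points in its
interior, and it is `K - 1` times continuously differentiable on `[0,1]`. -/
def IsSpline (K : ℕ) (G : Set ℝ) (f : ℝ → ℝ) : Prop :=
  (∀ a b : ℝ, 0 ≤ a → a < b → b ≤ 1 → Disjoint (Ioo a b) G →
    ∃ p : ℝ[X], p.natDegree ≤ K ∧ ∀ ζ ∈ Icc a b, f ζ = p.eval ζ) ∧
  ContDiffOn ℝ ((K - 1 : ℕ) : ℕ∞) f (Icc 0 1)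

/-- A basis of `N` zero-mean splines of degree `N` on the grid `{0, 1}` (no interior grid point):
a family linearly independent on `[0,1]`, each member having mean zero over `[0,1]`. -/
structure IsZeroMeanSplineBasis (N : ℕ) (φ : Fin N → ℝ → ℝ) : Prop where
  isSpline : ∀ i, IsSpline N {0, 1} (φ i)
  zeroMean : ∀ i, ∫ ζ in (0 : ℝ)..1, φ i ζ = 0
  linearIndependent : LinearIndependent ℝ fun i => (Icc (0 : ℝ) 1).domRestrict (φ i)

/-- The `i`-th B-spline of degree `k` for the knots `τ`, by the Cox--de Boor recursion (quotients
with denominator zero are zero). Degree zero is the indicator of `[τ i, τ (i+1))`, except at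
arguments `ζ ≥ 1`, where it is that of `(τ i, τ (i+1)]`: at the right end point `1` of the domain
`[0,1]` the value is the limit from the left. -/
def bspline (τ : ℕ → ℝ) : ℕ → ℕ → ℝ → ℝ
  | 0, i, ζ =>
      open Classical in
      if (ζ < 1 ∧ τ i ≤ ζ ∧ ζ < τ (i + 1)) ∨ (1 ≤ ζ ∧ τ i < ζ ∧ ζ ≤ τ (i + 1)) then 1 else 0
  | k + 1, i, ζ =>
      (ζ - τ i) / (τ (i + k + 1) - τ i) * bspline τ k i ζ +
        (τ (i + k + 2) - ζ) / (τ (i + k + 2) - τ (i + 1)) * bspline τ k (i + 1) ζ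

/-- The factor `μ` for which `b_i + μ b_{i+1}` has mean zero over `[0,1]`. -/
def constraintFactor (τ : ℕ → ℝ) (K i : ℕ) : ℝ :=
  -(∫ ζ in (0 : ℝ)..1, bspline τ K i ζ) / ∫ ζ in (0 : ℝ)..1, bspline τ K (i + 1) ζ

/-- The constrained spline `b_i + μ_i b_{i+1}` of degree `K`. -/
def constrainedSpline (τ : ℕ → ℝ) (K i : ℕ) (ζ : ℝ) : ℝ :=
  bspline τ K i ζ + constraintFactor τ K i * bspline τ K (i + 1) ζ

/-- The Legendre basis of degree `N`: the shifted Legendre polynomials of degrees `1, …, N` on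
`[0,1]`, normalized to the value `1` at `ζ = 0`; the index `i : Fin N` stands for degree `i + 1`. -/
def legendreBasis (N : ℕ) (i : Fin N) (ζ : ℝ) : ℝ :=
  Polynomial.aeval ζ (Polynomial.shiftedLegendre ((i : ℕ) + 1))

/-! ### Moment equations for a general basis `φ` -/

section Moments

variable {N : ℕ}

/-- `M_ij = ∫₀¹ φ_i φ_j`. -/
def massMatrix (φ : Fin N → ℝ → ℝ) : Matrix (Fin N) (Fin N) ℝ :=
  Matrix.of fun i j => ∫ ζ in (0 : ℝ)..1, φ i ζ * φ j ζ

/-- `A_ijk = ∫₀¹ φ_i φ_j φ_k`. -/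
def tensorA (φ : Fin N → ℝ → ℝ) (i j k : Fin N) : ℝ :=
  ∫ ζ in (0 : ℝ)..1, φ i ζ * φ j ζ * φ k ζ

/-- `B_ijk = ∫₀¹ φ_i'(ζ) (∫₀^ζ φ_j) φ_k(ζ) dζ`. -/
def tensorB (φ : Fin N → ℝ → ℝ) (i j k : Fin N) : ℝ :=
  ∫ ζ in (0 : ℝ)..1, deriv (φ i) ζ * (∫ x in (0 : ℝ)..ζ, φ j x) * φ k ζ

/-- The block diagonal matrix `diag(1, 1, X)`. -/
def diagBlock (X : Matrix (Fin N) (Fin N) ℝ) : Matrix (Fin 2 ⊕ Fin N) (Fin 2 ⊕ Fin N) ℝ :=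
  Matrix.fromBlocks 1 0 0 X

/-- The matrix in front of the `x`-derivative of `(h, h u, h s_1, …, h s_N)` in the moment system
with basis `φ`, at water height `h`, mean velocity `u`, coefficients `s`; `g` is gravity.
The `(i, l)` entry of its last block is the coefficient of `∂_x (h s_l)` in
`∂_x (h (2 u ∑_j M_ij s_j + ∑_jk A_ijk s_j s_k)) - u ∑_j M_ij ∂_x (h s_j)
  + ∑_jk B_ijk s_k ∂_x (h s_j)`. -/
def advectionMatrix (g : ℝ) (φ : Fin N → ℝ → ℝ) (h u : ℝ) (s : Fin N → ℝ) :
    Matrix (Fin 2 ⊕ Fin N) (Fin 2 ⊕ Fin N) ℝ :=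
  Matrix.fromBlocks
    !![0, 1; -u ^ 2 + g * h - ∑ j, ∑ k, massMatrix φ j k * s j * s k, 2 * u]
    (Matrix.of ![fun _ => 0, fun l => 2 * ∑ j, massMatrix φ l j * s j])
    (Matrix.of fun i =>
      ![-2 * u * ∑ j, massMatrix φ i j * s j - ∑ j, ∑ k, tensorA φ i j k * s j * s k,
        2 * ∑ j, massMatrix φ i j * s j])
    (Matrix.of fun i l =>
      ∑ j, (tensorB φ i l j + 2 * tensorA φ i j l) * s j + u * massMatrix φ i l)

/-- The system matrix `A_sys = diag(1, 1, M)⁻¹ A`. -/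
def systemMatrix (g : ℝ) (φ : Fin N → ℝ → ℝ) (h u : ℝ) (s : Fin N → ℝ) :
    Matrix (Fin 2 ⊕ Fin N) (Fin 2 ⊕ Fin N) ℝ :=
  (diagBlock (massMatrix φ))⁻¹ * advectionMatrix g φ h u s

/-- The variables `(h, h u, h s_1, …, h s_N)`. -/
def conservedVars (h u : ℝ) (s : Fin N → ℝ) : Fin 2 ⊕ Fin N → ℝ :=
  Sum.elim ![h, h * u] fun i => h * s i

/-- `(h, u, s)`, as functions of `(t, x)`, is on `Ω` a differentiable solution with positive height
of the first order system `E ∂_t U + A(h, u, s) ∂_x U = 0`, `U = (h, h u, h s)`. -/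
def IsSolution (E : Matrix (Fin 2 ⊕ Fin N) (Fin 2 ⊕ Fin N) ℝ)
    (A : ℝ → ℝ → (Fin N → ℝ) → Matrix (Fin 2 ⊕ Fin N) (Fin 2 ⊕ Fin N) ℝ)
    (Ω : Set (ℝ × ℝ)) (h u : ℝ × ℝ → ℝ) (s : ℝ × ℝ → Fin N → ℝ) : Prop :=
  ∀ p ∈ Ω, 0 < h p ∧
    DifferentiableAt ℝ (fun q => conservedVars (h q) (u q) (s q)) p ∧
    E *ᵥ (fderiv ℝ (fun q => conservedVars (h q) (u q) (s q)) p (1, 0)) +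
      A (h p) (u p) (s p) *ᵥ
        (fderiv ℝ (fun q => conservedVars (h q) (u q) (s q)) p (0, 1)) = 0

/-- A real square matrix is hyperbolic if it has a full set of real eigenvalues: it is
diagonalizable over `ℝ`. -/
def IsHyperbolic (A : Matrix (Fin 2 ⊕ Fin N) (Fin 2 ⊕ Fin N) ℝ) : Prop :=
  ∃ (P : Matrix (Fin 2 ⊕ Fin N) (Fin 2 ⊕ Fin N) ℝ) (d : Fin 2 ⊕ Fin N → ℝ),
    IsUnit P ∧ A = P * Matrix.diagonal d * P⁻¹

/-! ### Change of basis and regularization -/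

/-- `T = M^{LS} (M^S)⁻¹` with `M^{LS}_ij = ∫₀¹ φ_i^Leg φ_j`. -/
def transferMatrix (φ : Fin N → ℝ → ℝ) : Matrix (Fin N) (Fin N) ℝ :=
  (Matrix.of fun i j => ∫ ζ in (0 : ℝ)..1, legendreBasis N i ζ * φ j ζ) * (massMatrix φ)⁻¹

/-- The Legendre coefficients `α = T⁻ᵀ s` of the profile with spline coefficients `s`. -/
def legendreCoeffs (φ : Fin N → ℝ → ℝ) (s : Fin N → ℝ) : Fin N → ℝ :=
  ((transferMatrix φ)ᵀ)⁻¹ *ᵥ s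

/-- The spline coefficients `s̃_i = T_{1i} α₁`. -/
def linearProfileCoeffs [NeZero N] (φ : Fin N → ℝ → ℝ) (α₁ : ℝ) : Fin N → ℝ :=
  fun i => transferMatrix φ 0 i * α₁

/-- The HSWME matrix: the Legendre system matrix at `(h, u, α₁, 0, …, 0)`. -/
def hswmeMatrix [NeZero N] (g h u : ℝ) (α : Fin N → ℝ) :
    Matrix (Fin 2 ⊕ Fin N) (Fin 2 ⊕ Fin N) ℝ :=
  systemMatrix g (legendreBasis N) h u (Pi.single 0 (α 0))

/-- The HSSWME matrix: the spline system matrix at `(h, u, s̃)`, `s̃_i = T_{1i} α₁`, where `α₁` is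
the first Legendre coefficient of `s`. -/
def hsswmeMatrix [NeZero N] (g : ℝ) (φ : Fin N → ℝ → ℝ) (h u : ℝ) (s : Fin N → ℝ) :
    Matrix (Fin 2 ⊕ Fin N) (Fin 2 ⊕ Fin N) ℝ :=
  systemMatrix g φ h u (linearProfileCoeffs φ (legendreCoeffs φ s 0))

end Moments

end SSWME

end

noncomputable section

namespace SSWME

/-! ### Integration of polynomials over `[0,1]` -/

/-! Without interior knots a zero-mean spline of degree `N` is, on `[0,1]`, a single polynomial of
degree at most `N` with mean zero. Such polynomials form a space of dimension at most `N`, so any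
`N` independent ones span the Legendre polynomials of degrees `1, …, N`, and pairing with the basis
identifies the expansion matrix as `T`. With the velocity profile held fixed as a function, the
blocks of the advection matrix are linear or bilinear in the basis. A change of basis therefore acts
on the mass matrix and on the advection matrix by the same congruence (`gramMatrix_change`,
`polyAdvection_change`), hence on the system matrix by similarity. Since `T` is constant, it
commutes with differentiation and solutions correspond (`isSolution_change`).

By this similarity, hyperbolicity only has to be shown for the Legendre matrix at a linear profile
`a (1 - 2ζ)`. An explicit conjugation makes it block triangular. The 2×2 block has the eigenvalues
`u ± √(g h + a²)`; the other is `u + a M⁻¹ C` with `C` the transport matrix. Legendre's equation and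
integration by parts give `M = D G` and `C = D H` with the same positive diagonal `D`, where `G` and
`H` are Gram matrices of the derivatives with weights `ζ(1-ζ)` and `ζ(1-ζ)(1-2ζ)`. So `M⁻¹ C = G⁻¹
H` with `G` positive definite and `H` symmetric: it is diagonalizable, with eigenvalues in `[-1, 1]`
because `|1 - 2ζ| ≤ 1` (`exists_transport_eigenbasis`). As `|a| < √(g h + a²)` for `h > 0`, the two
blocks share no eigenvalue and the whole matrix is diagonalizable.

For the constrained B-splines the point is linear independence: Marsden's identity puts all powers
`(X - y)^N`, hence all polynomials of degree at most `N`, in the span of the `N + 1` B-splines,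
which are therefore independent; the constrained ones are bidiagonal combinations of them. -/

/-- The antiderivative of a polynomial that vanishes at zero. -/
def antideriv : ℝ[X] →ₗ[ℝ] ℝ[X] :=
  (Polynomial.basisMonomials ℝ).constr ℝ fun n => Polynomial.monomial (n + 1) ((n : ℝ) + 1)⁻¹

/-- The integral of a polynomial over `[0,1]`. -/
def unitIntegral : ℝ[X] →ₗ[ℝ] ℝ := (Polynomial.leval 1).comp antideriv

lemma antideriv_monomial (n : ℕ) (a : ℝ) :
    antideriv (Polynomial.monomial n a) = Polynomial.monomial (n + 1) (a * ((n : ℝ) + 1)⁻¹) := by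
  have h : Polynomial.monomial n a = a • Polynomial.basisMonomials ℝ n := by
    simp [Polynomial.smul_monomial]
  rw [h, map_smul, antideriv, Module.Basis.constr_basis, Polynomial.smul_monomial, smul_eq_mul]

lemma derivative_antideriv (p : ℝ[X]) : Polynomial.derivative (antideriv p) = p := by
  induction p using Polynomial.induction_on' with
  | add p q hp hq => rw [map_add, map_add, hp, hq]
  | monomial n a =>
    rw [antideriv_monomial, Polynomial.derivative_monomial]
    have : (n : ℝ) + 1 ≠ 0 := by positivity
    push_cast
    rw [inv_mul_cancel_right₀ this]

lemma eval_zero_antideriv (p : ℝ[X]) : (antideriv p).eval 0 = 0 := by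
  induction p using Polynomial.induction_on' with
  | add p q hp hq => rw [map_add, Polynomial.eval_add, hp, hq, add_zero]
  | monomial n a => rw [antideriv_monomial]; simp [Polynomial.eval_monomial]

lemma antideriv_derivative (p : ℝ[X]) (hp : p.eval 0 = 0) :
    antideriv (Polynomial.derivative p) = p := by
  have h : Polynomial.derivative (antideriv (Polynomial.derivative p) - p) = 0 := by
    rw [Polynomial.derivative_sub, derivative_antideriv, sub_self]
  rw [← sub_eq_zero, Polynomial.eq_C_of_derivative_eq_zero h, Polynomial.coeff_zero_eq_eval_zero,
    Polynomial.eval_sub, hp, eval_zero_antideriv, sub_zero, Polynomial.C_0]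

lemma integral_eval (p : ℝ[X]) (x : ℝ) :
    ∫ ζ in (0 : ℝ)..x, p.eval ζ = (antideriv p).eval x := by
  have h := intervalIntegral.integral_eq_sub_of_hasDerivAt (a := 0) (b := x)
    (fun y _ => (antideriv p).hasDerivAt y)
    (by rw [derivative_antideriv]; exact p.continuous.intervalIntegrable _ _)
  rwa [derivative_antideriv, eval_zero_antideriv, sub_zero] at h

lemma integral_eval_unit (p : ℝ[X]) : ∫ ζ in (0 : ℝ)..1, p.eval ζ = unitIntegral p :=
  integral_eval p 1

lemma unitIntegral_derivative (p : ℝ[X]) :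
    unitIntegral (Polynomial.derivative p) = p.eval 1 - p.eval 0 := by
  have h : antideriv (Polynomial.derivative p) = p - Polynomial.C (p.eval 0) := by
    rw [← antideriv_derivative (p - Polynomial.C (p.eval 0)) (by simp)]; simp
  simp [unitIntegral, h]

lemma unitIntegral_pos {p : ℝ[X]} (hp : p ≠ 0) (h : ∀ ζ ∈ Icc (0 : ℝ) 1, 0 ≤ p.eval ζ) :
    0 < unitIntegral p := by
  rw [← integral_eval_unit]
  refine intervalIntegral.integral_pos zero_lt_one p.continuous.continuousOn
    (fun x hx => h x (Ioc_subset_Icc_self hx)) ?_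
  by_contra! hc
  exact hp (Polynomial.eq_zero_of_infinite_isRoot p
    ((Icc_infinite (zero_lt_one' ℝ)).mono fun x hx => le_antisymm (hc x hx) (h x hx)))

lemma eq_of_eval_eq_on_Icc {p q : ℝ[X]} (h : ∀ ζ ∈ Icc (0 : ℝ) 1, p.eval ζ = q.eval ζ) : p = q :=
  Polynomial.eq_of_infinite_eval_eq p q ((Icc_infinite (zero_lt_one' ℝ)).mono h)

/-! ### Velocity profiles and weighted Gram matrices -/

/-- The polynomial with coefficients `s` in the family `p`. -/
def profile {N : ℕ} (p : Fin N → ℝ[X]) (s : Fin N → ℝ) : ℝ[X] := ∑ j, s j • p j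

/-- The Gram matrix of `p` in the space `L²([0,1])` with weight `w`. -/
def gramMatrix {N : ℕ} (w : ℝ[X]) (p : Fin N → ℝ[X]) : Matrix (Fin N) (Fin N) ℝ :=
  Matrix.of fun i j => unitIntegral (w * (p i * p j))

lemma gramMatrix_isHermitian {N : ℕ} (w : ℝ[X]) (p : Fin N → ℝ[X]) :
    (gramMatrix w p).IsHermitian := by
  ext i j
  simp [gramMatrix, mul_comm (p i)]

lemma dotProduct_gramMatrix {N : ℕ} (w : ℝ[X]) (p : Fin N → ℝ[X]) (s : Fin N → ℝ) :
    s ⬝ᵥ (gramMatrix w p *ᵥ s) = unitIntegral (w * (profile p s * profile p s)) := by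
  rw [profile, Finset.sum_mul_sum]
  simp only [dotProduct, mulVec, gramMatrix, Matrix.of_apply, Finset.mul_sum, map_sum]
  refine Finset.sum_congr rfl fun i _ => Finset.sum_congr rfl fun j _ => ?_
  simp only [smul_mul_assoc, mul_smul_comm, map_smul, smul_eq_mul]
  ring

lemma profile_ne_zero {N : ℕ} {p : Fin N → ℝ[X]} (hp : LinearIndependent ℝ p) {s : Fin N → ℝ}
    (hs : s ≠ 0) : profile p s ≠ 0 := fun h =>
  hs (funext fun i => Fintype.linearIndependent_iff.1 hp s h i)

lemma gramMatrix_posDef {N : ℕ} {w : ℝ[X]} (hw : w ≠ 0) (h : ∀ ζ ∈ Icc (0 : ℝ) 1, 0 ≤ w.eval ζ)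
    {p : Fin N → ℝ[X]} (hp : LinearIndependent ℝ p) : (gramMatrix w p).PosDef := by
  refine Matrix.PosDef.of_dotProduct_mulVec_pos (gramMatrix_isHermitian w p) fun s hs => ?_
  rw [star_trivial, dotProduct_gramMatrix]
  have := profile_ne_zero hp hs
  refine unitIntegral_pos (mul_ne_zero hw (mul_ne_zero this this)) fun ζ hζ => ?_
  rw [Polynomial.eval_mul, Polynomial.eval_mul]
  exact mul_nonneg (h ζ hζ) (mul_self_nonneg _)

/-! ### The moment system of a polynomial basis -/

/-- The advection matrix for the polynomial basis `p` and the velocity profile `u + f`. -/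
def polyAdvection {N : ℕ} (g h u : ℝ) (f : ℝ[X]) (p : Fin N → ℝ[X]) :
    Matrix (Fin 2 ⊕ Fin N) (Fin 2 ⊕ Fin N) ℝ :=
  Matrix.fromBlocks
    !![0, 1; -u ^ 2 + g * h - unitIntegral (f * f), 2 * u]
    (Matrix.of ![fun _ => 0, fun l => 2 * unitIntegral (p l * f)])
    (Matrix.of fun i =>
      ![-2 * u * unitIntegral (p i * f) - unitIntegral (p i * (f * f)),
        2 * unitIntegral (p i * f)])
    (Matrix.of fun i l =>
      unitIntegral (Polynomial.derivative (p i) * antideriv (p l) * f)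
        + 2 * unitIntegral (p i * f * p l) + u * unitIntegral (p i * p l))

section Transfer

variable {N : ℕ} {φ : Fin N → ℝ → ℝ} {p : Fin N → ℝ[X]}

lemma massMatrix_eq (hφ : ∀ i, ∀ ζ ∈ Icc (0 : ℝ) 1, φ i ζ = (p i).eval ζ) :
    massMatrix φ = gramMatrix 1 p := by
  ext i j
  simp only [massMatrix, gramMatrix, Matrix.of_apply, one_mul, ← integral_eval_unit]
  refine intervalIntegral.integral_congr fun ζ hζ => ?_
  rw [uIcc_of_le zero_le_one] at hζ
  simp [hφ _ ζ hζ]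

lemma tensorA_eq (hφ : ∀ i, ∀ ζ ∈ Icc (0 : ℝ) 1, φ i ζ = (p i).eval ζ) (i j k : Fin N) :
    tensorA φ i j k = unitIntegral (p i * p j * p k) := by
  simp only [tensorA, ← integral_eval_unit]
  refine intervalIntegral.integral_congr fun ζ hζ => ?_
  rw [uIcc_of_le zero_le_one] at hζ
  simp [hφ _ ζ hζ]

lemma tensorB_eq (hφ : ∀ i, ∀ ζ ∈ Icc (0 : ℝ) 1, φ i ζ = (p i).eval ζ) (i j k : Fin N) :
    tensorB φ i j k =
      unitIntegral (Polynomial.derivative (p i) * antideriv (p j) * p k) := by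
  simp only [tensorB, ← integral_eval_unit]
  -- Only interior points are compared: `φ i` is unconstrained outside `[0,1]`, so `deriv (φ i)` is
  -- not controlled at the two end points, which have measure zero.
  refine intervalIntegral.integral_congr_Ioo_of_le zero_le_one fun ζ hζ => ?_
  have h1 : deriv (φ i) ζ = (Polynomial.derivative (p i)).eval ζ := by
    rw [← Polynomial.deriv]
    refine Filter.EventuallyEq.deriv_eq ?_
    filter_upwards [Ioo_mem_nhds hζ.1 hζ.2] with x hx using hφ i x (Ioo_subset_Icc_self hx)
  have h2 : ∫ x in (0 : ℝ)..ζ, φ j x = (antideriv (p j)).eval ζ := by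
    rw [← integral_eval]
    refine intervalIntegral.integral_congr fun x hx => ?_
    rw [uIcc_of_le hζ.1.le] at hx
    exact hφ j x ⟨hx.1, hx.2.trans hζ.2.le⟩
  simp [h1, h2, hφ k ζ (Ioo_subset_Icc_self hζ)]

/-- By linearity of the integral the coefficients enter only through the profile they represent;
this lets the basis change while the profile stays fixed. -/
lemma advectionMatrix_eq (hφ : ∀ i, ∀ ζ ∈ Icc (0 : ℝ) 1, φ i ζ = (p i).eval ζ) (g h u : ℝ)
    (s : Fin N → ℝ) : advectionMatrix g φ h u s = polyAdvection g h u (profile p s) p := by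
  have h1 : ∀ i, ∑ j, massMatrix φ i j * s j = unitIntegral (p i * profile p s) := fun i => by
    simp only [massMatrix_eq hφ, gramMatrix, Matrix.of_apply, profile, Finset.mul_sum, map_sum,
      mul_smul_comm, map_smul, smul_eq_mul, one_mul]
    exact Finset.sum_congr rfl fun j _ => mul_comm _ _
  have h2 : ∑ j, ∑ k, massMatrix φ j k * s j * s k =
      unitIntegral (profile p s * profile p s) := by
    simp only [massMatrix_eq hφ, gramMatrix, Matrix.of_apply, profile, Finset.sum_mul_sum, map_sum,
      mul_smul_comm, smul_mul_assoc, map_smul, smul_eq_mul, one_mul]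
    exact Finset.sum_congr rfl fun j _ => Finset.sum_congr rfl fun k _ => by ring
  have h3 : ∀ i, ∑ j, ∑ k, tensorA φ i j k * s j * s k =
      unitIntegral (p i * (profile p s * profile p s)) := fun i => by
    rw [profile, Finset.sum_mul_sum]
    simp only [tensorA_eq hφ, Finset.mul_sum, map_sum,
      mul_smul_comm, smul_mul_assoc, map_smul, smul_eq_mul, mul_assoc]
    exact Finset.sum_congr rfl fun j _ => Finset.sum_congr rfl fun k _ => by ring
  have h4 : ∀ i l, ∑ j, (tensorB φ i l j + 2 * tensorA φ i j l) * s j =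
      unitIntegral (Polynomial.derivative (p i) * antideriv (p l) * profile p s)
        + 2 * unitIntegral (p i * profile p s * p l) := fun i l => by
    simp only [tensorA_eq hφ, tensorB_eq hφ, profile, Finset.sum_mul, Finset.mul_sum, map_sum,
      mul_smul_comm, smul_mul_assoc, map_smul, smul_eq_mul]
    rw [← Finset.sum_add_distrib]
    exact Finset.sum_congr rfl fun j _ => by ring
  have h5 : ∀ i l, massMatrix φ i l = unitIntegral (p i * p l) := fun i l => by
    simp [massMatrix_eq hφ, gramMatrix]
  simp only [advectionMatrix, polyAdvection, h1, h2, h3, h4]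
  simp only [h5]

end Transfer

/-! ### Change of basis -/

section ChangeOfBasis

variable {N : ℕ}

lemma diagBlock_mul (X Y : Matrix (Fin N) (Fin N) ℝ) :
    diagBlock X * diagBlock Y = diagBlock (X * Y) := by
  simp [diagBlock, Matrix.fromBlocks_multiply]

lemma diagBlock_one : diagBlock (1 : Matrix (Fin N) (Fin N) ℝ) = 1 := Matrix.fromBlocks_one

lemma isUnit_diagBlock {X : Matrix (Fin N) (Fin N) ℝ} (hX : IsUnit X) : IsUnit (diagBlock X) := by
  rw [Matrix.isUnit_iff_isUnit_det] at hX ⊢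
  simpa [diagBlock] using hX

lemma bilinear_change {p q : Fin N → ℝ[X]} {T : Matrix (Fin N) (Fin N) ℝ}
    (hq : ∀ i, q i = ∑ l, T i l • p l) (β : ℝ[X] →ₗ[ℝ] ℝ[X] →ₗ[ℝ] ℝ) :
    (Matrix.of fun i j => β (q i) (q j)) = T * (Matrix.of fun i j => β (p i) (p j)) * Tᵀ := by
  ext i j
  simp only [Matrix.of_apply, Matrix.mul_apply, Matrix.transpose_apply, hq i, hq j, map_sum,
    LinearMap.sum_apply, Finset.sum_mul, map_smul, LinearMap.smul_apply, smul_eq_mul,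
    Finset.mul_sum]
  exact Finset.sum_congr rfl fun a _ => Finset.sum_congr rfl fun b _ => by ring

lemma gramMatrix_change {p q : Fin N → ℝ[X]} {T : Matrix (Fin N) (Fin N) ℝ}
    (hq : ∀ i, q i = ∑ l, T i l • p l) (w : ℝ[X]) :
    gramMatrix w q = T * gramMatrix w p * Tᵀ :=
  bilinear_change hq (LinearMap.mk₂ ℝ (fun a b => unitIntegral (w * (a * b)))
    (fun _ _ _ => by simp [add_mul, mul_add]) (fun _ _ _ => by simp)
    (fun _ _ _ => by simp [mul_add]) (fun _ _ _ => by simp))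

lemma profile_change {p q : Fin N → ℝ[X]} {T : Matrix (Fin N) (Fin N) ℝ}
    (hq : ∀ i, q i = ∑ l, T i l • p l) (α : Fin N → ℝ) :
    profile q α = profile p (Tᵀ *ᵥ α) := by
  simp only [profile, hq, Matrix.mulVec, dotProduct, Matrix.transpose_apply, Finset.smul_sum,
    Finset.sum_smul, smul_smul]
  rw [Finset.sum_comm]
  refine Finset.sum_congr rfl fun a _ => Finset.sum_congr rfl fun b _ => ?_
  rw [mul_comm]

/-- For fixed `f` the off-diagonal blocks are linear in the basis, the last block is bilinear, and
the first does not involve the basis. -/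
lemma polyAdvection_change {p q : Fin N → ℝ[X]} {T : Matrix (Fin N) (Fin N) ℝ}
    (hq : ∀ i, q i = ∑ l, T i l • p l) (g h u : ℝ) (f : ℝ[X]) :
    polyAdvection g h u f q = diagBlock T * polyAdvection g h u f p * diagBlock Tᵀ := by
  simp only [polyAdvection, diagBlock, Matrix.fromBlocks_multiply, Matrix.zero_mul,
    Matrix.mul_zero, add_zero, zero_add, Matrix.one_mul, Matrix.mul_one]
  have h1 : ∀ (r : ℝ[X]) i, unitIntegral (q i * r) = ∑ l, T i l * unitIntegral (p l * r) :=
    fun r i => by simp [hq, Finset.sum_mul]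
  congr 1
  · ext i l
    fin_cases i
    · simp [Matrix.mul_apply]
    · simp only [Matrix.mul_apply, h1, Matrix.of_apply, Matrix.transpose_apply, Fin.mk_one,
        Matrix.cons_val_one, Matrix.cons_val_fin_one, Finset.mul_sum]
      exact Finset.sum_congr rfl fun _ _ => by ring
  · ext i l
    fin_cases l
    · simp only [Matrix.mul_apply, h1, Matrix.of_apply, Fin.zero_eta, Matrix.cons_val_zero,
        Finset.mul_sum, mul_sub, Finset.sum_sub_distrib]
      congr 1
      exact Finset.sum_congr rfl fun _ _ => by ring
    · simp only [Matrix.mul_apply, h1, Matrix.of_apply, Fin.mk_one,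
        Matrix.cons_val_one, Matrix.cons_val_fin_one, Finset.mul_sum]
      exact Finset.sum_congr rfl fun _ _ => by ring
  · exact bilinear_change hq (LinearMap.mk₂ ℝ (fun a b =>
      unitIntegral (Polynomial.derivative a * antideriv b * f) + 2 * unitIntegral (a * f * b)
        + u * unitIntegral (a * b))
      (fun _ _ _ => by simp only [map_add, add_mul]; ring)
      (fun _ _ _ => by
        simp only [smul_mul_assoc, map_smul, smul_eq_mul]; ring)
      (fun _ _ _ => by simp only [map_add, add_mul, mul_add]; ring)
      (fun _ _ _ => by simp only [mul_smul_comm, smul_mul_assoc, map_smul, smul_eq_mul]; ring))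

/-- Two first order systems, one of which is obtained from the other by the linear change of
variables `diag(1, 1, X)` and multiplication by an invertible matrix, have the same solutions. -/
lemma isSolution_change {E E' P : Matrix (Fin 2 ⊕ Fin N) (Fin 2 ⊕ Fin N) ℝ}
    {A A' : ℝ → ℝ → (Fin N → ℝ) → Matrix (Fin 2 ⊕ Fin N) (Fin 2 ⊕ Fin N) ℝ}
    {X : Matrix (Fin N) (Fin N) ℝ} (hP : IsUnit P) (hX : IsUnit X)
    (hE : E' = P * E * diagBlock X)
    (hA : ∀ h u s, A' h u (X⁻¹ *ᵥ s) = P * A h u s * diagBlock X)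
    (Ω : Set (ℝ × ℝ)) (h u : ℝ × ℝ → ℝ) (s : ℝ × ℝ → Fin N → ℝ) :
    IsSolution E A Ω h u s ↔ IsSolution E' A' Ω h u (fun p => X⁻¹ *ᵥ s p) := by
  have hdet := (Matrix.isUnit_iff_isUnit_det _).1 hX
  have hU : ∀ a b c, conservedVars a b (X⁻¹ *ᵥ c) = (diagBlock X⁻¹) *ᵥ conservedVars a b c := by
    intro a b c
    rw [diagBlock, conservedVars, conservedVars, Matrix.fromBlocks_mulVec]
    congr 1
    · simp
    · have : (fun i => a * c i) = a • c := rfl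
      simp only [Matrix.zero_mulVec, zero_add, Sum.elim_comp_inr, this, Matrix.mulVec_smul]
      rfl
  -- A constant linear equivalence passes through differentiability in both directions and through
  -- `fderiv`.
  let Λ : (Fin 2 ⊕ Fin N → ℝ) ≃L[ℝ] (Fin 2 ⊕ Fin N → ℝ) :=
    (Matrix.toLinearEquiv' (diagBlock X⁻¹)
      (isUnit_diagBlock (Matrix.isUnit_nonsing_inv_iff.2 hX)).invertible).toContinuousLinearEquiv
  have hΛ : ∀ v, Λ v = diagBlock X⁻¹ *ᵥ v := fun v => rfl
  have hinv : ∀ v, diagBlock X *ᵥ (diagBlock X⁻¹ *ᵥ v) = v := fun v => by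
    rw [Matrix.mulVec_mulVec, diagBlock_mul, Matrix.mul_nonsing_inv _ hdet, diagBlock_one,
      Matrix.one_mulVec]
  refine forall₂_congr fun p _ => and_congr_right fun _ => ?_
  simp only [hU, ← hΛ]
  rw [show (fun q => Λ (conservedVars (h q) (u q) (s q))) =
    Λ ∘ fun q => conservedVars (h q) (u q) (s q) from rfl, Λ.comp_differentiableAt_iff,
    Λ.comp_fderiv, hA, hE]
  refine and_congr_right fun _ => ?_
  simp only [ContinuousLinearMap.comp_apply, ContinuousLinearEquiv.coe_coe, hΛ,
    ← Matrix.mulVec_mulVec, hinv, ← Matrix.mulVec_add]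
  rw [← (Matrix.mulVec_injective_of_isUnit hP).eq_iff, Matrix.mulVec_zero]

end ChangeOfBasis

/-! ### Hyperbolicity -/

/-- The spectral theorem is used twice: `B` normalizes `G` to the identity, then an orthogonal `V`
diagonalizes the still symmetric `Bᵀ H B` without disturbing that identity. -/
lemma exists_simultaneous_diagonalization {n : Type*} [Fintype n] [DecidableEq n]
    {G H : Matrix n n ℝ} (hG : G.PosDef) (hH : H.IsHermitian) :
    ∃ (P : Matrix n n ℝ) (d : n → ℝ), IsUnit P ∧ Pᵀ * G * P = 1 ∧ Pᵀ * H * P = diagonal d := by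
  have key : ∀ {S : Matrix n n ℝ} (hS : S.IsHermitian),
      ∃ U : Matrix n n ℝ, Uᵀ * U = 1 ∧ Uᵀ * S * U = diagonal hS.eigenvalues := fun {S} hS => by
    refine ⟨hS.eigenvectorUnitary, ?_, ?_⟩
    · simpa [Matrix.star_eq_conjTranspose] using
        Unitary.coe_star_mul_self hS.eigenvectorUnitary
    · have := hS.conjStarAlgAut_star_eigenvectorUnitary
      simpa [Unitary.conjStarAlgAut_star_apply, Matrix.star_eq_conjTranspose] using this
  obtain ⟨U, hU, hUG⟩ := key hG.1
  set r : n → ℝ := fun i => (Real.sqrt (hG.1.eigenvalues i))⁻¹ with hr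
  set B := U * diagonal r with hB
  have hBG : Bᵀ * G * B = 1 := by
    have : Bᵀ * G * B = diagonal r * (Uᵀ * G * U) * diagonal r := by
      simp only [hB, transpose_mul, diagonal_transpose, Matrix.mul_assoc]
    rw [this, hUG, diagonal_mul_diagonal, diagonal_mul_diagonal, ← diagonal_one]
    congr 1
    ext i
    have h0 := hG.eigenvalues_pos i
    have h1 := Real.mul_self_sqrt h0.le
    have h2 := (Real.sqrt_pos.2 h0).ne'
    simp only [hr]
    field_simp
    rw [pow_two, h1]
  have hBH : (Bᵀ * H * B).IsHermitian := by
    simpa using isHermitian_conjTranspose_mul_mul B hH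
  obtain ⟨V, hV, hVH⟩ := key hBH
  have h1 : (B * V)ᵀ * G * (B * V) = 1 := by
    have : (B * V)ᵀ * G * (B * V) = Vᵀ * (Bᵀ * G * B) * V := by
      simp only [transpose_mul, Matrix.mul_assoc]
    rw [this, hBG, Matrix.mul_one, hV]
  refine ⟨B * V, hBH.eigenvalues, ?_, h1, ?_⟩
  · exact (Matrix.isUnit_iff_isUnit_det _).2 (Matrix.isUnit_det_of_left_inverse h1)
  · rw [← hVH, transpose_mul]
    simp only [Matrix.mul_assoc]

lemma IsHyperbolic.conj {N : ℕ} {A Q : Matrix (Fin 2 ⊕ Fin N) (Fin 2 ⊕ Fin N) ℝ}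
    (hA : IsHyperbolic A) (hQ : IsUnit Q) : IsHyperbolic (Q * A * Q⁻¹) := by
  obtain ⟨P, d, hP, rfl⟩ := hA
  refine ⟨Q * P, d, hQ.mul hP, ?_⟩
  rw [Matrix.mul_inv_rev]
  simp only [Matrix.mul_assoc]

/-- A block triangular matrix with diagonalizable diagonal blocks without common eigenvalue is
hyperbolic. -/
lemma isHyperbolic_fromBlocks {N : ℕ} {X : Matrix (Fin 2) (Fin 2) ℝ}
    {Y : Matrix (Fin 2) (Fin N) ℝ} {Z : Matrix (Fin N) (Fin N) ℝ}
    {P : Matrix (Fin 2) (Fin 2) ℝ} {Q : Matrix (Fin N) (Fin N) ℝ} {c : Fin 2 → ℝ} {d : Fin N → ℝ}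
    (hP : IsUnit P) (hQ : IsUnit Q) (hX : X * P = P * diagonal c) (hZ : Z * Q = Q * diagonal d)
    (hcd : ∀ i j, c i ≠ d j) : IsHyperbolic (Matrix.fromBlocks X Y 0 Z) := by
  have hPd := (Matrix.isUnit_iff_isUnit_det _).1 hP
  have hQd := (Matrix.isUnit_iff_isUnit_det _).1 hQ
  set W := P⁻¹ * Y * Q with hW
  -- `K` solves the Sylvester equation that removes the coupling block; disjointness of the two
  -- spectra makes the denominators nonzero.
  set K : Matrix (Fin 2) (Fin N) ℝ := Matrix.of fun i j => W i j / (d j - c i) with hK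
  have hKW : diagonal c * K + W = K * diagonal d := by
    ext i j
    have : d j - c i ≠ 0 := sub_ne_zero.2 (hcd i j).symm
    rw [Matrix.add_apply, Matrix.diagonal_mul, Matrix.mul_diagonal, hK, Matrix.of_apply]
    field_simp
    ring
  have hR : IsUnit (Matrix.fromBlocks P (P * K) 0 Q) := by
    rw [Matrix.isUnit_iff_isUnit_det, Matrix.det_fromBlocks_zero₂₁]
    exact hPd.mul hQd
  refine ⟨Matrix.fromBlocks P (P * K) 0 Q, Sum.elim c d, hR, ?_⟩
  have h : Matrix.fromBlocks X Y 0 Z * Matrix.fromBlocks P (P * K) 0 Q =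
      Matrix.fromBlocks P (P * K) 0 Q * diagonal (Sum.elim c d) := by
    rw [← Matrix.fromBlocks_diagonal, Matrix.fromBlocks_multiply, Matrix.fromBlocks_multiply]
    simp only [Matrix.mul_zero, Matrix.zero_mul, add_zero, zero_add, hX, hZ]
    congr 1
    rw [← Matrix.mul_assoc, hX, Matrix.mul_assoc P K, ← hKW, Matrix.mul_add, hW,
      Matrix.mul_assoc, Matrix.mul_assoc P⁻¹, ← Matrix.mul_assoc P P⁻¹,
      Matrix.mul_nonsing_inv _ hPd, Matrix.one_mul]
  rw [← h, Matrix.mul_nonsing_inv_cancel_right _ _ ((Matrix.isUnit_iff_isUnit_det _).1 hR)]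

/-! ### Shifted Legendre polynomials -/

/-- The shifted Legendre polynomial with real coefficients. -/
def realLegendre (n : ℕ) : ℝ[X] := (Polynomial.shiftedLegendre n).map (Int.castRingHom ℝ)

/-- The polynomials of the Legendre basis. -/
def legendrePoly (N : ℕ) (i : Fin N) : ℝ[X] := realLegendre ((i : ℕ) + 1)

/-- The weight `ζ (1 - ζ)`. -/
def bubble : ℝ[X] := Polynomial.X - Polynomial.X ^ 2

/-- The linear profile `1 - 2ζ`. -/
def linearPoly : ℝ[X] := 1 - 2 * Polynomial.X

lemma legendreBasis_eq (N : ℕ) (i : Fin N) (ζ : ℝ) :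
    legendreBasis N i ζ = (legendrePoly N i).eval ζ := by
  rw [legendreBasis, legendrePoly, realLegendre, Polynomial.eval_map]
  rfl

lemma realLegendre_one : realLegendre 1 = linearPoly := by
  simp only [realLegendre, linearPoly, Polynomial.shiftedLegendre, Finset.sum_range_succ,
    Finset.sum_range_zero]
  simp
  ring

lemma natDegree_realLegendre (n : ℕ) : (realLegendre n).natDegree = n := by
  rw [realLegendre, Polynomial.natDegree_map_eq_of_injective Int.cast_injective,
    Polynomial.natDegree_shiftedLegendre]

lemma realLegendre_ne_zero (n : ℕ) : realLegendre n ≠ 0 := by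
  rw [realLegendre, Ne, Polynomial.map_eq_zero_iff Int.cast_injective]
  intro h
  have := Polynomial.degree_shiftedLegendre n
  simp [h] at this

lemma linearIndependent_legendrePoly (N : ℕ) : LinearIndependent ℝ (legendrePoly N) := by
  let S : Polynomial.Sequence ℝ := ⟨realLegendre, fun n => by
    rw [Polynomial.degree_eq_natDegree (realLegendre_ne_zero n), natDegree_realLegendre]⟩
  exact S.linearIndependent.comp (fun i : Fin N => (i : ℕ) + 1)
    fun i j h => Fin.ext (Nat.succ_injective h)

/-- Ratio of consecutive explicit coefficients; this is Legendre's equation read off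
coefficientwise. -/
lemma coeff_realLegendre_succ (n k : ℕ) :
    ((k : ℝ) + 1) ^ 2 * (realLegendre n).coeff (k + 1) =
      (k * (k + 1) - n * (n + 1)) * (realLegendre n).coeff k := by
  simp only [realLegendre, Polynomial.coeff_map, Polynomial.coeff_shiftedLegendre, eq_intCast]
  push_cast
  have h1 : (n.choose (k + 1) : ℝ) * (k + 1) = n.choose k * (n - k) := by
    rcases le_or_gt k n with hk | hk
    · have := Nat.choose_succ_right_eq n k
      rw [← Nat.cast_sub hk]
      exact_mod_cast this
    · rw [Nat.choose_eq_zero_of_lt hk, Nat.choose_eq_zero_of_lt (hk.trans k.lt_succ_self)]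
      simp
  have h2 : ((n + (k + 1)).choose n : ℝ) * (k + 1) = (n + k).choose n * (n + k + 1) := by
    have := Nat.choose_mul_succ_eq (n + k) n
    rw [show n + k + 1 - n = k + 1 by omega] at this
    exact_mod_cast this.symm
  calc _ = -((-1 : ℝ) ^ k) * ((n.choose (k + 1) : ℝ) * (k + 1)) *
        (((n + (k + 1)).choose n : ℝ) * (k + 1)) := by ring
    _ = _ := by rw [h1, h2]; ring

/-- Legendre's differential equation. -/
lemma legendre_ode (n : ℕ) :
    Polynomial.derivative (bubble * Polynomial.derivative (realLegendre n)) =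
      (-((n : ℝ) * (n + 1))) • realLegendre n := by
  ext k
  have h : (bubble * Polynomial.derivative (realLegendre n)).coeff (k + 1) =
      (realLegendre n).coeff (k + 1) * (k + 1) - k * (realLegendre n).coeff k := by
    rw [bubble, sub_mul, Polynomial.coeff_sub, Polynomial.coeff_X_mul, pow_two, mul_assoc,
      Polynomial.coeff_X_mul, Polynomial.coeff_derivative]
    cases k with
    | zero => simp
    | succ k => rw [Polynomial.coeff_X_mul, Polynomial.coeff_derivative]; push_cast; ring
  rw [Polynomial.coeff_derivative, h, Polynomial.coeff_smul, smul_eq_mul]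
  linear_combination coeff_realLegendre_succ n k

lemma bubble_eval_zero : bubble.eval 0 = 0 := by simp [bubble]

lemma bubble_eval_one : bubble.eval 1 = 0 := by simp [bubble]

lemma bubble_ne_zero : bubble ≠ 0 := fun h => by
  have : bubble.eval 2 = 0 := by rw [h, Polynomial.eval_zero]
  norm_num [bubble] at this

lemma bubble_nonneg {ζ : ℝ} (hζ : ζ ∈ Icc (0 : ℝ) 1) : 0 ≤ bubble.eval ζ := by
  simp only [bubble, Polynomial.eval_sub, Polynomial.eval_X, Polynomial.eval_pow]
  nlinarith [mul_nonneg hζ.1 (sub_nonneg.2 hζ.2)]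

/-- The factor `1 / (n (n + 1))` for `n = i + 1`. -/
def legendreFactor (i : ℕ) : ℝ := (((i : ℝ) + 1) * (i + 2))⁻¹

lemma legendreFactor_pos (i : ℕ) : 0 < legendreFactor i := by
  rw [legendreFactor]; positivity

/-- Legendre's equation integrated from `0`, where `ζ (1 - ζ)` vanishes. Its vanishing at `1` then
gives mean zero. -/
lemma antideriv_legendrePoly {N : ℕ} (i : Fin N) :
    antideriv (legendrePoly N i) =
      (-legendreFactor i) • (bubble * Polynomial.derivative (legendrePoly N i)) := by
  have h : Polynomial.derivative
      ((-legendreFactor i) • (bubble * Polynomial.derivative (legendrePoly N i))) =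
      legendrePoly N i := by
    rw [Polynomial.derivative_smul, legendrePoly, legendre_ode, smul_smul, legendreFactor]
    push_cast
    convert one_smul ℝ _ using 2
    field_simp
    ring
  nth_rewrite 1 [← h]
  exact antideriv_derivative _ (by simp [bubble_eval_zero])

lemma unitIntegral_legendrePoly {N : ℕ} (i : Fin N) : unitIntegral (legendrePoly N i) = 0 := by
  change (antideriv (legendrePoly N i)).eval 1 = 0
  simp [antideriv_legendrePoly, bubble_eval_one]

/-- By Legendre's equation the linear map `r ↦ (ζ(1-ζ) r)'` sends these derivatives to nonzero
multiples of the independent Legendre polynomials. -/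
lemma linearIndependent_derivative_legendrePoly (N : ℕ) :
    LinearIndependent ℝ fun i => Polynomial.derivative (legendrePoly N i) := by
  refine LinearIndependent.of_comp
    (Polynomial.derivative ∘ₗ LinearMap.mulLeft ℝ bubble) ?_
  let w : Fin N → ℝˣ := fun i => Units.mk0 _ (neg_ne_zero.2 (legendreFactor_pos i).ne')
  rw [← LinearIndependent.units_smul_iff _ w]
  convert linearIndependent_legendrePoly N using 1
  ext1 i
  rw [← derivative_antideriv (legendrePoly N i), antideriv_legendrePoly,
    Polynomial.derivative_smul]
  rfl

/-! ### Integral identities for the linear profile -/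

lemma unitIntegral_nonneg {p : ℝ[X]} (h : ∀ ζ ∈ Icc (0 : ℝ) 1, 0 ≤ p.eval ζ) :
    0 ≤ unitIntegral p := by
  rcases eq_or_ne p 0 with rfl | hp
  · simp
  · exact (unitIntegral_pos hp h).le

lemma eval_linearPoly (ζ : ℝ) : linearPoly.eval ζ = 1 - 2 * ζ := by
  simp [linearPoly]

lemma derivative_linearPoly : Polynomial.derivative linearPoly = -2 := by
  simp [linearPoly]

lemma unitIntegral_linearPoly_sq : unitIntegral (linearPoly * linearPoly) = 1 / 3 := by
  have h : linearPoly * linearPoly = Polynomial.derivative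
      (Polynomial.X - 2 * Polynomial.X ^ 2 + Polynomial.C (4 / 3) * Polynomial.X ^ 3) := by
    refine Polynomial.funext fun x => ?_
    simp [linearPoly]
    ring
  rw [h, unitIntegral_derivative]
  norm_num

/-- Write `P`, `R` for the antiderivatives and `L = 1 - 2ζ`. The function `p R L + P L r + 2 P R`
vanishes at both end points; since `L' = -2`, the last summand cancels the terms in `L'`, and its
derivative is `p' R L + 2 p L r + P L r'`. With `P` a multiple of `ζ(1-ζ) p'`, the right-hand side
becomes a symmetric form in the derivatives. -/
lemma advection_eq_neg_unitIntegral {p r : ℝ[X]} (hp : unitIntegral p = 0)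
    (hr : unitIntegral r = 0) :
    unitIntegral (Polynomial.derivative p * antideriv r * linearPoly)
        + 2 * unitIntegral (p * linearPoly * r) =
      -unitIntegral (antideriv p * linearPoly * Polynomial.derivative r) := by
  have hp' : (antideriv p).eval 1 = 0 := hp
  have hr' : (antideriv r).eval 1 = 0 := hr
  have h := unitIntegral_derivative (p * antideriv r * linearPoly
    + antideriv p * linearPoly * r + 2 * (antideriv p * antideriv r))
  have h2 : Polynomial.derivative (p * antideriv r * linearPoly
      + antideriv p * linearPoly * r + 2 * (antideriv p * antideriv r)) =
      Polynomial.derivative p * antideriv r * linearPoly + (2 : ℝ) • (p * linearPoly * r)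
        + antideriv p * linearPoly * Polynomial.derivative r := by
    simp only [Polynomial.derivative_add, Polynomial.derivative_mul, derivative_antideriv,
      derivative_linearPoly, Polynomial.derivative_ofNat, ofNat_smul_eq_nsmul, nsmul_eq_mul]
    push_cast
    ring
  rw [h2, map_add, map_add, map_smul, smul_eq_mul] at h
  simp only [Polynomial.eval_add, Polynomial.eval_mul, hp', hr', eval_zero_antideriv] at h
  linarith

lemma unitIntegral_mul_derivative {p r : ℝ[X]} (hp : unitIntegral p = 0) :
    unitIntegral (p * r) = -unitIntegral (antideriv p * Polynomial.derivative r) := by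
  have hp' : (antideriv p).eval 1 = 0 := hp
  have h := unitIntegral_derivative (antideriv p * r)
  rw [Polynomial.derivative_mul, derivative_antideriv, map_add] at h
  simp only [Polynomial.eval_mul, hp', eval_zero_antideriv] at h
  linarith

lemma unitIntegral_linearPoly : unitIntegral linearPoly = 0 := by
  have h := unitIntegral_derivative bubble
  rw [bubble_eval_one, bubble_eval_zero, sub_zero] at h
  convert h using 2
  refine Polynomial.funext fun x => ?_
  simp [bubble, linearPoly]
  norm_num

/-- Both sides equal `2 ∫ P L`, with `P` the antiderivative of `p` and `L = 1 - 2ζ`. The factor one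
half is what decouples the height from the moments in `isHyperbolic_legendre`. -/
lemma advection_linearPoly {p : ℝ[X]} (hp : unitIntegral p = 0) :
    unitIntegral (Polynomial.derivative p * antideriv linearPoly * linearPoly)
        + 2 * unitIntegral (p * linearPoly * linearPoly) =
      unitIntegral (p * (linearPoly * linearPoly)) / 2 := by
  rw [advection_eq_neg_unitIntegral hp unitIntegral_linearPoly,
    unitIntegral_mul_derivative (r := linearPoly * linearPoly) hp, derivative_linearPoly,
    Polynomial.derivative_mul, derivative_linearPoly]
  have : antideriv p * (-2 * linearPoly + linearPoly * -2) =
      (2 : ℝ) • (antideriv p * linearPoly * -2) := by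
    rw [ofNat_smul_eq_nsmul, nsmul_eq_mul]
    push_cast
    ring
  rw [this, map_smul, smul_eq_mul]
  ring

/-! ### Hyperbolicity of the linearized Legendre system -/

/-- The matrix of the transport part of the moment system at the profile `1 - 2ζ`. -/
def transportMatrix (N : ℕ) : Matrix (Fin N) (Fin N) ℝ :=
  Matrix.of fun i l =>
    unitIntegral (Polynomial.derivative (legendrePoly N i) * antideriv (legendrePoly N l) *
      linearPoly) + 2 * unitIntegral (legendrePoly N i * linearPoly * legendrePoly N l)

lemma gramMatrix_legendrePoly (N : ℕ) :
    gramMatrix 1 (legendrePoly N) = diagonal (fun i : Fin N => legendreFactor i) *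
      gramMatrix bubble fun i => Polynomial.derivative (legendrePoly N i) := by
  ext i j
  rw [Matrix.diagonal_mul, gramMatrix, gramMatrix, Matrix.of_apply, Matrix.of_apply, one_mul,
    unitIntegral_mul_derivative (unitIntegral_legendrePoly i), antideriv_legendrePoly]
  simp only [smul_mul_assoc, map_smul, smul_eq_mul, mul_assoc]
  ring

/-- The left factor is the one in `gramMatrix_legendrePoly`, so it cancels from the generalized
eigenvalue problem and leaves a symmetric one. -/
lemma transportMatrix_eq (N : ℕ) :
    transportMatrix N = diagonal (fun i : Fin N => legendreFactor i) *
      gramMatrix (bubble * linearPoly) fun i => Polynomial.derivative (legendrePoly N i) := by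
  ext i j
  rw [Matrix.diagonal_mul, gramMatrix, transportMatrix, Matrix.of_apply, Matrix.of_apply,
    advection_eq_neg_unitIntegral (unitIntegral_legendrePoly i) (unitIntegral_legendrePoly j),
    antideriv_legendrePoly]
  simp only [smul_mul_assoc, map_smul, smul_eq_mul, mul_assoc, mul_left_comm linearPoly]
  ring

/-- The transport part is diagonalizable with respect to the mass matrix, with eigenvalues in
`[-1, 1]`. -/
lemma exists_transport_eigenbasis (N : ℕ) :
    ∃ (P : Matrix (Fin N) (Fin N) ℝ) (d : Fin N → ℝ), IsUnit P ∧ (∀ i, |d i| ≤ 1) ∧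
      transportMatrix N * P = gramMatrix 1 (legendrePoly N) * P * diagonal d := by
  set q' : Fin N → ℝ[X] := fun i => Polynomial.derivative (legendrePoly N i) with hq'
  obtain ⟨P, d, hP, hG, hH⟩ := exists_simultaneous_diagonalization
    (gramMatrix_posDef bubble_ne_zero (fun ζ => bubble_nonneg)
      (linearIndependent_derivative_legendrePoly N))
    (gramMatrix_isHermitian (bubble * linearPoly) q')
  refine ⟨P, d, hP, ?_, ?_⟩
  · intro i
    -- These eigenfunctions are orthonormal for the weight `ζ(1-ζ)`, so `d i` is a weighted mean of
    -- `1 - 2ζ`, which lies in `[-1, 1]`.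
    set r : Fin N → ℝ[X] := fun i => ∑ l, Pᵀ i l • q' l with hr
    have h1 := gramMatrix_change (T := Pᵀ) (p := q') (q := r) (fun _ => rfl) bubble
    have h2 := gramMatrix_change (T := Pᵀ) (p := q') (q := r) (fun _ => rfl) (bubble * linearPoly)
    rw [transpose_transpose, hG] at h1
    rw [transpose_transpose, hH] at h2
    have h1 : unitIntegral (bubble * (r i * r i)) = 1 := by simpa [gramMatrix] using congr($h1 i i)
    have h2 : unitIntegral (bubble * linearPoly * (r i * r i)) = d i := by
      simpa [gramMatrix] using congr($h2 i i)
    rw [abs_le]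
    constructor
    · have := unitIntegral_nonneg (p := bubble * (1 + linearPoly) * (r i * r i)) fun ζ hζ => by
        simp only [Polynomial.eval_mul, Polynomial.eval_add, eval_linearPoly, Polynomial.eval_one]
        exact mul_nonneg (mul_nonneg (bubble_nonneg hζ) (by linarith [hζ.2])) (mul_self_nonneg _)
      rw [mul_add, mul_one, add_mul, map_add, h1, h2] at this
      linarith
    · have := unitIntegral_nonneg (p := bubble * (1 - linearPoly) * (r i * r i)) fun ζ hζ => by
        simp only [Polynomial.eval_mul, Polynomial.eval_sub, eval_linearPoly, Polynomial.eval_one]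
        exact mul_nonneg (mul_nonneg (bubble_nonneg hζ) (by linarith [hζ.1])) (mul_self_nonneg _)
      rw [mul_sub, mul_one, sub_mul, map_sub, h1, h2] at this
      linarith
  · rw [transportMatrix_eq, gramMatrix_legendrePoly]
    simp only [Matrix.mul_assoc]
    congr 1
    have hPt : IsUnit Pᵀ := by
      rw [Matrix.isUnit_iff_isUnit_det] at hP ⊢
      rwa [Matrix.det_transpose]
    refine hPt.mul_left_cancel ?_
    rw [← Matrix.mul_assoc, hH, ← Matrix.mul_assoc, ← Matrix.mul_assoc, hG, Matrix.one_mul]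

/-- Conjugation by `Q` gives a block triangular matrix whose diagonal blocks are diagonalizable with
disjoint spectra. -/
lemma isHyperbolic_legendre {N : ℕ} [NeZero N] {g h : ℝ} (hg : 0 < g) (hh : 0 < h) (u a : ℝ) :
    IsHyperbolic (systemMatrix g (legendreBasis N) h u (Pi.single 0 a)) := by
  set q := legendrePoly N with hq
  set M := gramMatrix 1 q with hM
  have hMU : IsUnit M := (gramMatrix_posDef one_ne_zero (by simp)
    (linearIndependent_legendrePoly N)).isUnit
  have hMd := (Matrix.isUnit_iff_isUnit_det _).1 hMU
  have hq0 : q 0 = linearPoly := by simp [hq, legendrePoly, realLegendre_one]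
  have hprof : profile q (Pi.single 0 a) = a • linearPoly := by
    rw [← hq0, profile, Finset.sum_eq_single 0] <;> simp +contextual
  have hM0 : ∀ i, M i 0 = unitIntegral (q i * linearPoly) := fun i => by
    simp [hM, gramMatrix, hq0]
  have hC0 : ∀ i, transportMatrix N i 0 = unitIntegral (q i * (linearPoly * linearPoly)) / 2 :=
    fun i => by
      rw [← advection_linearPoly (unitIntegral_legendrePoly i), transportMatrix, Matrix.of_apply,
        ← hq, hq0]
  set Z := a • (M⁻¹ * transportMatrix N) + u • (1 : Matrix (Fin N) (Fin N) ℝ) with hZ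
  have hMZ : M * Z = a • transportMatrix N + u • M := by
    rw [hZ, Matrix.mul_add, Matrix.mul_smul, Matrix.mul_smul, Matrix.mul_one,
      Matrix.mul_nonsing_inv_cancel_left _ _ hMd]
  set Y : Matrix (Fin 2) (Fin N) ℝ := Matrix.of ![fun _ => 0, fun l => 2 * (a * M l 0)] with hY
  -- In terms of differentials, `Q⁻¹` passes from `(h, h u, h s)` to `dh`, `h du` and, in the first
  -- moment, `h² d(s₁ / h)`, hence the entry `2 * a`. By `hC0` exactly this multiple cancels the
  -- lower left block.
  set Q : Matrix (Fin 2 ⊕ Fin N) (Fin 2 ⊕ Fin N) ℝ :=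
    Matrix.fromBlocks !![1, 0; u, 1] 0
      (Matrix.of fun i => ![(Pi.single 0 (2 * a) : Fin N → ℝ) i, 0]) 1 with hQ
  set X : Matrix (Fin 2) (Fin 2) ℝ := !![u, 1; g * h + a ^ 2, u] with hX
  have hQU : IsUnit Q := by
    rw [Matrix.isUnit_iff_isUnit_det, hQ, Matrix.det_fromBlocks_zero₁₂]
    simp
  have hA : advectionMatrix g (legendreBasis N) h u (Pi.single 0 a) * Q =
      diagBlock M * (Q * Matrix.fromBlocks X Y 0 Z) := by
    have hMe : ∀ i, ∑ x, M i x * (Pi.single 0 (2 * a) : Fin N → ℝ) x = M i 0 * (2 * a) := fun i => by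
      rw [Finset.sum_eq_single 0] <;> simp +contextual
    rw [advectionMatrix_eq (fun i ζ _ => legendreBasis_eq N i ζ), hprof, polyAdvection, diagBlock,
      ← Matrix.mul_assoc, hQ]
    simp only [Matrix.fromBlocks_multiply, Matrix.zero_mul, Matrix.mul_zero, add_zero, zero_add,
      Matrix.one_mul, Matrix.mul_one, hMZ]
    congr 1
    -- The entry `a ^ 2` of `X` is `-a²/3` from the advection matrix plus `4a²/3` from this sum, by
    -- `∫ (1 - 2ζ)² = 1/3`.
    · have hsum : ∑ x, unitIntegral (q x * linearPoly) * (Pi.single 0 (2 * a) : Fin N → ℝ) x =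
          2 * a * (1 / 3) := by
        rw [Finset.sum_eq_single 0] <;> simp +contextual [hq0, unitIntegral_linearPoly_sq]
        ring
      ext i j
      fin_cases i <;> fin_cases j <;>
        simp [hX, Matrix.mul_apply, Fin.sum_univ_two, ← hq, unitIntegral_linearPoly_sq,
          Matrix.vecMul, dotProduct]
      · simp only [mul_assoc, ← Finset.mul_sum, hsum]
        ring
      · ring
    · ext i l
      fin_cases i <;> simp [hY, Matrix.mul_apply, Fin.sum_univ_two, hM0, ← hq]
    · have hT : ∀ i, ∑ x, (unitIntegral (Polynomial.derivative (q i) * antideriv (q x) *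
          (a • linearPoly)) + 2 * unitIntegral (q i * (a • linearPoly) * q x)
          + u * unitIntegral (q i * q x)) * (Pi.single 0 (2 * a) : Fin N → ℝ) x =
          (a * transportMatrix N i 0 + u * M i 0) * (2 * a) := fun i => by
        rw [Finset.sum_eq_single 0] <;> simp +contextual [transportMatrix, gramMatrix, hM, ← hq]
        left
        ring
      ext i l
      fin_cases l <;> simp [hX, Matrix.mul_apply, Fin.sum_univ_two, ← hq]
      · simp only [smul_eq_mul, Algebra.smul_mul_assoc, Algebra.mul_smul_comm, map_smul] at hT
        rw [hT, hMe, hC0, hM0]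
        ring
      · rw [hMe, hM0]
        ring
    · ext i l
      simp [hY, Matrix.mul_apply, Fin.sum_univ_two, transportMatrix, hM, gramMatrix, ← hq]
      ring
  have hS : systemMatrix g (legendreBasis N) h u (Pi.single 0 a) =
      Q * Matrix.fromBlocks X Y 0 Z * Q⁻¹ := by
    have hE := (Matrix.isUnit_iff_isUnit_det _).1 (isUnit_diagBlock hMU)
    rw [systemMatrix, massMatrix_eq fun i ζ _ => legendreBasis_eq N i ζ, ← hq, ← hM,
      ← Matrix.nonsing_inv_mul_cancel_left _ (Q * _) hE, ← hA, Matrix.mul_assoc, Matrix.mul_assoc,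
      Matrix.mul_nonsing_inv _ ((Matrix.isUnit_iff_isUnit_det _).1 hQU), Matrix.mul_one]
  rw [hS]
  refine IsHyperbolic.conj ?_ hQU
  obtain ⟨P, d, hP, hd, hCP⟩ := exists_transport_eigenbasis N
  have hpos : 0 < g * h + a ^ 2 := by positivity
  have hr2 := Real.sq_sqrt hpos.le
  have hr0 := Real.sqrt_pos.2 hpos
  set r := Real.sqrt (g * h + a ^ 2) with hr
  refine isHyperbolic_fromBlocks (P := !![1, 1; r, -r]) (Q := P) (c := ![u + r, u - r])
    (d := fun i => a * d i + u) ?_ hP ?_ ?_ ?_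
  · rw [Matrix.isUnit_iff_isUnit_det, Matrix.det_fin_two_of, isUnit_iff_ne_zero]
    linarith
  · ext i j
    fin_cases i <;> fin_cases j <;> simp [hX, Matrix.mul_apply, Fin.sum_univ_two] <;>
      first | ring1 | linear_combination hr2 | linear_combination -hr2
  · have : (diagonal fun i => a * d i + u) = a • diagonal d + u • (1 : Matrix (Fin N) (Fin N) ℝ) := by
      ext i j
      rcases eq_or_ne i j with rfl | hij
      · simp
      · simp [hij]
    rw [this, hZ, Matrix.add_mul, Matrix.mul_add, Matrix.smul_mul, Matrix.smul_mul, Matrix.one_mul,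
      Matrix.mul_smul, Matrix.mul_smul, Matrix.mul_one, Matrix.mul_assoc, hCP, Matrix.mul_assoc,
      Matrix.nonsing_inv_mul_cancel_left _ _ hMd]
  -- Strictness comes from `g h > 0`; it separates `u + a d_j` from `u ± r`.
  · have hlt : ∀ j, (a * d j) ^ 2 < r ^ 2 := fun j => by
      have : d j ^ 2 ≤ 1 := (sq_le_one_iff_abs_le_one _).2 (hd j)
      rw [hr2, mul_pow]
      nlinarith [sq_nonneg a, mul_pos hg hh]
    intro i j hij
    have := hlt j
    fin_cases i
    · have : a * d j = r := by simp at hij; linarith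
      simp_all
    · have : a * d j = -r := by simp at hij; linarith
      simp_all

/-! ### Zero-mean spline bases -/

lemma IsZeroMeanSplineBasis.exists_polynomial {N : ℕ} {φ : Fin N → ℝ → ℝ}
    (hφ : IsZeroMeanSplineBasis N φ) :
    ∃ p : Fin N → ℝ[X], (∀ i, (p i).natDegree ≤ N) ∧
      (∀ i, ∀ ζ ∈ Icc (0 : ℝ) 1, φ i ζ = (p i).eval ζ) ∧ (∀ i, unitIntegral (p i) = 0) ∧
      LinearIndependent ℝ p := by
  have h : ∀ i, ∃ p : ℝ[X], p.natDegree ≤ N ∧ ∀ ζ ∈ Icc (0 : ℝ) 1, φ i ζ = p.eval ζ :=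
    fun i => (hφ.isSpline i).1 0 1 le_rfl zero_lt_one le_rfl (by
      rw [Set.disjoint_left]
      rintro x ⟨h0, h1⟩ (rfl | rfl)
      · exact lt_irrefl _ h0
      · exact lt_irrefl _ h1)
  choose p hpN hp using h
  refine ⟨p, hpN, hp, fun i => ?_, ?_⟩
  · rw [← integral_eval_unit]
    refine Eq.trans (intervalIntegral.integral_congr fun ζ hζ => ?_) (hφ.zeroMean i)
    rw [uIcc_of_le zero_le_one] at hζ
    exact (hp i ζ hζ).symm
  · refine Fintype.linearIndependent_iff.2 fun c hc =>
      Fintype.linearIndependent_iff.1 hφ.linearIndependent c ?_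
    ext ⟨ζ, hζ⟩
    have := congr(Polynomial.eval ζ $hc)
    simpa [Polynomial.eval_finsetSum, hp _ ζ hζ] using this

/-- The polynomials of degree at most `N` with mean zero over `[0,1]`. -/
def zeroMeanPoly (N : ℕ) : Submodule ℝ ℝ[X] :=
  Polynomial.degreeLT ℝ (N + 1) ⊓ LinearMap.ker unitIntegral

lemma mem_zeroMeanPoly {N : ℕ} {p : ℝ[X]} (h : p.natDegree ≤ N) (h0 : unitIntegral p = 0) :
    p ∈ zeroMeanPoly N :=
  ⟨Polynomial.mem_degreeLT.2 (lt_of_le_of_lt (Polynomial.natDegree_le_iff_degree_le.1 h)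
    (by exact_mod_cast N.lt_succ_self)), h0⟩

lemma finrank_degreeLT (n : ℕ) : Module.finrank ℝ (Polynomial.degreeLT ℝ n) = n := by
  rw [(Polynomial.degreeLTEquiv ℝ n).finrank_eq, Module.finrank_fin_fun]

instance finite_degreeLT (n : ℕ) : Module.Finite ℝ (Polynomial.degreeLT ℝ n) :=
  Module.Finite.equiv (Polynomial.degreeLTEquiv ℝ n).symm

/-- The constant `1` has nonzero mean, so the inclusion into the polynomials of degree at most `N`
is strict. -/
lemma finrank_zeroMeanPoly_le (N : ℕ) : Module.finrank ℝ (zeroMeanPoly N) ≤ N := by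
  have hlt : zeroMeanPoly N < Polynomial.degreeLT ℝ (N + 1) := by
    refine lt_of_le_of_ne inf_le_left fun h => ?_
    have h1 : (1 : ℝ[X]) ∈ zeroMeanPoly N := by
      rw [h, Polynomial.mem_degreeLT, Polynomial.degree_one]
      exact_mod_cast N.succ_pos
    have h2 : unitIntegral 1 = 0 := h1.2
    exact (unitIntegral_pos one_ne_zero (by simp)).ne' h2
  have := Submodule.finrank_lt_finrank_of_lt hlt
  rw [finrank_degreeLT] at this
  omega

lemma exists_expansion {N : ℕ} {p : Fin N → ℝ[X]} (hpN : ∀ i, (p i).natDegree ≤ N)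
    (hp0 : ∀ i, unitIntegral (p i) = 0) (hp : LinearIndependent ℝ p) {q : ℝ[X]}
    (hqN : q.natDegree ≤ N) (hq0 : unitIntegral q = 0) : ∃ c : Fin N → ℝ, q = ∑ l, c l • p l := by
  have : Module.Finite ℝ (zeroMeanPoly N) :=
    Submodule.finiteDimensional_of_le (inf_le_left : _ ≤ Polynomial.degreeLT ℝ (N + 1))
  let p' : Fin N → zeroMeanPoly N := fun i => ⟨p i, mem_zeroMeanPoly (hpN i) (hp0 i)⟩
  have hp' : LinearIndependent ℝ p' :=
    LinearIndependent.of_comp (zeroMeanPoly N).subtype hp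
  have hcard : Fintype.card (Fin N) = Module.finrank ℝ (zeroMeanPoly N) :=
    le_antisymm hp'.fintype_card_le_finrank (by simpa using finrank_zeroMeanPoly_le N)
  have htop := hp'.span_eq_top_of_card_eq_finrank' hcard
  have hq : (⟨q, mem_zeroMeanPoly hqN hq0⟩ : zeroMeanPoly N) ∈ Submodule.span ℝ (range p') := by
    rw [htop]; trivial
  obtain ⟨c, hc⟩ := (Submodule.mem_span_range_iff_exists_fun ℝ).1 hq
  refine ⟨c, ?_⟩
  have := congr((zeroMeanPoly N).subtype $hc)
  simpa [p'] using this.symm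

lemma natDegree_legendrePoly_le {N : ℕ} (i : Fin N) : (legendrePoly N i).natDegree ≤ N := by
  rw [legendrePoly, natDegree_realLegendre]
  exact i.2

lemma isUnit_massMatrix_legendreBasis (N : ℕ) : IsUnit (massMatrix (legendreBasis N)) := by
  rw [massMatrix_eq fun i ζ _ => legendreBasis_eq N i ζ]
  exact (gramMatrix_posDef one_ne_zero (by simp) (linearIndependent_legendrePoly N)).isUnit

section Spline

variable {N : ℕ} {φ : Fin N → ℝ → ℝ}

lemma IsZeroMeanSplineBasis.isUnit_massMatrix (hφ : IsZeroMeanSplineBasis N φ) :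
    IsUnit (massMatrix φ) := by
  obtain ⟨p, -, hp, -, hli⟩ := hφ.exists_polynomial
  rw [massMatrix_eq hp]
  exact (gramMatrix_posDef one_ne_zero (by simp) hli).isUnit

/-- A zero-mean spline basis consists of polynomials, in which the transfer matrix expands the
Legendre basis. -/
lemma IsZeroMeanSplineBasis.exists_polynomial_transfer (hφ : IsZeroMeanSplineBasis N φ) :
    ∃ p : Fin N → ℝ[X], (∀ i, ∀ ζ ∈ Icc (0 : ℝ) 1, φ i ζ = (p i).eval ζ) ∧
      ∀ i, legendrePoly N i = ∑ l, transferMatrix φ i l • p l := by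
  obtain ⟨p, hpN, hp, hp0, hli⟩ := hφ.exists_polynomial
  refine ⟨p, hp, ?_⟩
  choose T hT using fun i : Fin N => exists_expansion hpN hp0 hli (natDegree_legendrePoly_le i)
    (unitIntegral_legendrePoly i)
  have hMLS : (Matrix.of fun i j => ∫ ζ in (0 : ℝ)..1, legendreBasis N i ζ * φ j ζ) =
      Matrix.of T * massMatrix φ := by
    ext i j
    have : ∫ ζ in (0 : ℝ)..1, legendreBasis N i ζ * φ j ζ =
        unitIntegral (legendrePoly N i * p j) := by
      rw [← integral_eval_unit]
      refine intervalIntegral.integral_congr fun ζ hζ => ?_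
      rw [uIcc_of_le zero_le_one] at hζ
      simp [legendreBasis_eq, hp j ζ hζ]
    rw [Matrix.of_apply, this, massMatrix_eq hp, hT i]
    simp [Matrix.mul_apply, gramMatrix, Finset.sum_mul]
  have : transferMatrix φ = Matrix.of T := by
    rw [transferMatrix, hMLS, Matrix.mul_nonsing_inv_cancel_right _ _
      ((Matrix.isUnit_iff_isUnit_det _).1 hφ.isUnit_massMatrix)]
  simpa [this] using hT

lemma IsZeroMeanSplineBasis.massMatrix_legendreBasis (hφ : IsZeroMeanSplineBasis N φ) :
    massMatrix (legendreBasis N) =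
      transferMatrix φ * massMatrix φ * (transferMatrix φ)ᵀ := by
  obtain ⟨p, hp, hT⟩ := hφ.exists_polynomial_transfer
  rw [massMatrix_eq hp, massMatrix_eq fun i ζ _ => legendreBasis_eq N i ζ]
  exact gramMatrix_change hT 1

/-- `det T` divides the nonzero determinant of the Legendre mass matrix. -/
lemma IsZeroMeanSplineBasis.isUnit_transferMatrix (hφ : IsZeroMeanSplineBasis N φ) :
    IsUnit (transferMatrix φ) := by
  have h := (Matrix.isUnit_iff_isUnit_det _).1 (isUnit_massMatrix_legendreBasis N)
  rw [hφ.massMatrix_legendreBasis, Matrix.det_mul, Matrix.det_mul] at h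
  exact (Matrix.isUnit_iff_isUnit_det _).2 (isUnit_of_mul_isUnit_left (isUnit_of_mul_isUnit_left h))

lemma IsZeroMeanSplineBasis.isUnit_transferMatrix_transpose (hφ : IsZeroMeanSplineBasis N φ) :
    IsUnit (transferMatrix φ)ᵀ := by
  have h := hφ.isUnit_transferMatrix
  rw [Matrix.isUnit_iff_isUnit_det] at h ⊢
  rwa [Matrix.det_transpose]

lemma IsZeroMeanSplineBasis.legendreBasis_eq_sum (hφ : IsZeroMeanSplineBasis N φ) (i : Fin N)
    {ζ : ℝ} (hζ : ζ ∈ Icc (0 : ℝ) 1) :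
    legendreBasis N i ζ = ∑ l, transferMatrix φ i l * φ l ζ := by
  obtain ⟨p, hp, hT⟩ := hφ.exists_polynomial_transfer
  rw [legendreBasis_eq, hT i]
  simp [Polynomial.eval_finsetSum, hp _ ζ hζ]

lemma IsZeroMeanSplineBasis.advectionMatrix_legendreBasis (hφ : IsZeroMeanSplineBasis N φ)
    (g h u : ℝ) (s : Fin N → ℝ) :
    advectionMatrix g (legendreBasis N) h u (legendreCoeffs φ s) =
      diagBlock (transferMatrix φ) * advectionMatrix g φ h u s *
        diagBlock (transferMatrix φ)ᵀ := by
  obtain ⟨p, hp, hT⟩ := hφ.exists_polynomial_transfer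
  rw [advectionMatrix_eq hp, advectionMatrix_eq fun i ζ _ => legendreBasis_eq N i ζ,
    profile_change hT, legendreCoeffs, Matrix.mulVec_mulVec, Matrix.mul_nonsing_inv _
      ((Matrix.isUnit_iff_isUnit_det _).1 hφ.isUnit_transferMatrix_transpose), Matrix.one_mulVec]
  exact polyAdvection_change hT g h u _

/-- Mass and advection matrices undergo the same congruence, so the left factor `T` cancels in `M⁻¹
A`. -/
lemma IsZeroMeanSplineBasis.systemMatrix_eq (hφ : IsZeroMeanSplineBasis N φ) (g h u : ℝ)
    (s : Fin N → ℝ) :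
    systemMatrix g φ h u s = diagBlock (transferMatrix φ)ᵀ *
      systemMatrix g (legendreBasis N) h u (legendreCoeffs φ s) *
      (diagBlock (transferMatrix φ)ᵀ)⁻¹ := by
  have h1 := (Matrix.isUnit_iff_isUnit_det _).1 (isUnit_diagBlock hφ.isUnit_transferMatrix)
  have h2 := (Matrix.isUnit_iff_isUnit_det _).1
    (isUnit_diagBlock hφ.isUnit_transferMatrix_transpose)
  rw [systemMatrix, systemMatrix, hφ.advectionMatrix_legendreBasis, hφ.massMatrix_legendreBasis,
    ← diagBlock_mul, ← diagBlock_mul, Matrix.mul_inv_rev, Matrix.mul_inv_rev]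
  simp only [Matrix.mul_assoc]
  rw [Matrix.mul_nonsing_inv _ h2, Matrix.mul_one, Matrix.nonsing_inv_mul_cancel_left _ _ h1,
    Matrix.mul_nonsing_inv_cancel_left _ _ h2]

lemma IsZeroMeanSplineBasis.isSolution_iff (hφ : IsZeroMeanSplineBasis N φ) (g : ℝ)
    (Ω : Set (ℝ × ℝ)) (h u : ℝ × ℝ → ℝ) (s : ℝ × ℝ → Fin N → ℝ) :
    IsSolution (diagBlock (massMatrix φ)) (advectionMatrix g φ) Ω h u s ↔
      IsSolution (diagBlock (massMatrix (legendreBasis N))) (advectionMatrix g (legendreBasis N))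
        Ω h u fun p => legendreCoeffs φ (s p) :=
  isSolution_change (isUnit_diagBlock hφ.isUnit_transferMatrix) hφ.isUnit_transferMatrix_transpose
    (by rw [hφ.massMatrix_legendreBasis, diagBlock_mul, diagBlock_mul])
    (fun h u s => hφ.advectionMatrix_legendreBasis g h u s) Ω h u s

variable [NeZero N]

lemma IsZeroMeanSplineBasis.legendreCoeffs_linearProfileCoeffs (hφ : IsZeroMeanSplineBasis N φ)
    (a : ℝ) : legendreCoeffs φ (linearProfileCoeffs φ a) = Pi.single 0 a := by
  have h : linearProfileCoeffs φ a = (transferMatrix φ)ᵀ *ᵥ Pi.single 0 a := by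
    ext i
    simp [linearProfileCoeffs]
  rw [legendreCoeffs, h, Matrix.mulVec_mulVec, Matrix.nonsing_inv_mul _
      ((Matrix.isUnit_iff_isUnit_det _).1 hφ.isUnit_transferMatrix_transpose), Matrix.one_mulVec]

lemma IsZeroMeanSplineBasis.sum_linearProfileCoeffs (hφ : IsZeroMeanSplineBasis N φ) (a : ℝ)
    {ζ : ℝ} (hζ : ζ ∈ Icc (0 : ℝ) 1) :
    ∑ i, linearProfileCoeffs φ a i * φ i ζ = a * (1 - 2 * ζ) := by
  have h := hφ.legendreBasis_eq_sum 0 hζ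
  rw [legendreBasis_eq, legendrePoly, Fin.val_zero, zero_add, realLegendre_one,
    eval_linearPoly] at h
  rw [h, Finset.mul_sum]
  exact Finset.sum_congr rfl fun i _ => by rw [linearProfileCoeffs]; ring

lemma IsZeroMeanSplineBasis.hsswmeMatrix_eq (hφ : IsZeroMeanSplineBasis N φ) (g h u : ℝ)
    (s : Fin N → ℝ) :
    hsswmeMatrix g φ h u s = diagBlock (transferMatrix φ)ᵀ *
      hswmeMatrix g h u (legendreCoeffs φ s) * (diagBlock (transferMatrix φ)ᵀ)⁻¹ := by
  rw [hsswmeMatrix, hφ.systemMatrix_eq, hφ.legendreCoeffs_linearProfileCoeffs, hswmeMatrix]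

lemma IsZeroMeanSplineBasis.isSolution_hsswme_iff (hφ : IsZeroMeanSplineBasis N φ) (g : ℝ)
    (Ω : Set (ℝ × ℝ)) (h u : ℝ × ℝ → ℝ) (s : ℝ × ℝ → Fin N → ℝ) :
    IsSolution 1 (hsswmeMatrix g φ) Ω h u s ↔
      IsSolution 1 (hswmeMatrix g) Ω h u fun p => legendreCoeffs φ (s p) := by
  have hU := isUnit_diagBlock hφ.isUnit_transferMatrix_transpose
  have hd := (Matrix.isUnit_iff_isUnit_det _).1 hU
  refine isSolution_change (Matrix.isUnit_nonsing_inv_iff.2 hU)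
    hφ.isUnit_transferMatrix_transpose ?_ (fun h u s => ?_) Ω h u s
  · rw [Matrix.mul_one, Matrix.nonsing_inv_mul _ hd]
  · rw [hφ.hsswmeMatrix_eq, Matrix.mul_assoc, Matrix.nonsing_inv_mul_cancel_right _ _ hd,
      Matrix.nonsing_inv_mul_cancel_left _ _ hd]
    rfl

end Spline

/-! ### B-splines without interior knots -/

/-- The polynomial that agrees on `[0,1]` with the `i`-th B-spline of degree `k`, for knots with
`τ N = 0` and `τ (N + 1) = 1`. -/
def bsplinePoly (N : ℕ) (τ : ℕ → ℝ) : ℕ → ℕ → ℝ[X]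
  | 0, i => if i = N then 1 else 0
  | k + 1, i =>
      Polynomial.C (τ (i + k + 1) - τ i)⁻¹ * (Polynomial.X - Polynomial.C (τ i)) *
          bsplinePoly N τ k i +
        Polynomial.C (τ (i + k + 2) - τ (i + 1))⁻¹ *
          (Polynomial.C (τ (i + k + 2)) - Polynomial.X) * bsplinePoly N τ k (i + 1)

section BSpline

variable {N : ℕ} {τ : ℕ → ℝ}

lemma eval_bsplinePoly_succ (k i : ℕ) (x : ℝ) :
    (bsplinePoly N τ (k + 1) i).eval x =
      (x - τ i) / (τ (i + k + 1) - τ i) * (bsplinePoly N τ k i).eval x +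
        (τ (i + k + 2) - x) / (τ (i + k + 2) - τ (i + 1)) *
          (bsplinePoly N τ k (i + 1)).eval x := by
  simp only [bsplinePoly, Polynomial.eval_add, Polynomial.eval_mul, Polynomial.eval_sub,
    Polynomial.eval_C, Polynomial.eval_X]
  ring

lemma natDegree_bsplinePoly_le (k i : ℕ) : (bsplinePoly N τ k i).natDegree ≤ k := by
  induction k generalizing i with
  | zero => rw [bsplinePoly]; split_ifs <;> simp
  | succ k ih =>
    rw [bsplinePoly]
    refine Polynomial.natDegree_add_le_of_degree_le ?_ ?_
    · rw [add_comm k 1]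
      refine Polynomial.natDegree_mul_le_of_le (Polynomial.natDegree_C_mul_le _ _ |>.trans ?_) (ih _)
      exact (Polynomial.natDegree_X_sub_C _).le
    · rw [add_comm k 1]
      refine Polynomial.natDegree_mul_le_of_le (Polynomial.natDegree_C_mul_le _ _ |>.trans ?_) (ih _)
      refine (Polynomial.natDegree_sub_le _ _).trans ?_
      simp

/-- For these indices the knot span `[τ i, τ (i + k + 1)]` lies to the right of `1` or to the left
of `0`. -/
lemma bsplinePoly_eq_zero {k i : ℕ} (h : N < i ∨ i + k < N) : bsplinePoly N τ k i = 0 := by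
  induction k generalizing i with
  | zero => rw [bsplinePoly, if_neg (by omega)]
  | succ k ih =>
    rw [bsplinePoly, ih (by omega), ih (by omega)]
    simp

/-- The combinations are bidiagonal with diagonal `c`: comparing coefficients of `b` from the first
index upwards kills one unknown after another, whatever `μ` is. -/
lemma linearIndependent_add_smul_succ {V : Type*} [AddCommGroup V] [Module ℝ V]
    {b : Fin (N + 1) → V} (hb : LinearIndependent ℝ b) {c : Fin N → ℝ} (hc : ∀ i, c i ≠ 0)
    (μ : Fin N → ℝ) :
    LinearIndependent ℝ fun i : Fin N => c i • (b i.castSucc + μ i • b i.succ) := by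
  refine Fintype.linearIndependent_iff.2 fun d hd => ?_
  have h := Fintype.linearIndependent_iff.1 hb
    ((Fin.snoc (fun i => d i * c i) 0 : Fin (N + 1) → ℝ) +
      (Fin.cons 0 fun i => d i * c i * μ i : Fin (N + 1) → ℝ)) (by
    simp only [Pi.add_apply, add_smul, Finset.sum_add_distrib]
    rw [Fin.sum_univ_castSucc, Fin.sum_univ_succ (n := N)]
    simp only [Fin.snoc_castSucc, Fin.snoc_last, Fin.cons_zero, Fin.cons_succ, zero_smul, add_zero,
      zero_add, ← Finset.sum_add_distrib]
    rw [← hd]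
    refine Finset.sum_congr rfl fun i _ => ?_
    simp only [smul_add, smul_smul, mul_assoc])
  have key : ∀ n, ∀ hn : n < N, d ⟨n, hn⟩ = 0 := fun n => by
    induction n with
    | zero =>
      intro hn
      have := h (Fin.castSucc ⟨0, hn⟩)
      rw [Pi.add_apply, Fin.snoc_castSucc, show Fin.castSucc ⟨0, hn⟩ = 0 from rfl,
        Fin.cons_zero, add_zero] at this
      exact (mul_eq_zero.1 this).resolve_right (hc _)
    | succ n ih =>
      intro hn
      have := h (Fin.castSucc ⟨n + 1, hn⟩)
      rw [Pi.add_apply, Fin.snoc_castSucc,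
        show Fin.castSucc ⟨n + 1, hn⟩ = Fin.succ ⟨n, by omega⟩ from rfl,
        Fin.cons_succ, ih, zero_mul, zero_mul, add_zero] at this
      exact (mul_eq_zero.1 this).resolve_right (hc _)
  exact fun i => key i i.2

variable (hτ : Monotone τ) (h0 : τ N = 0) (h1 : τ (N + 1) = 1)

include hτ h0 h1

lemma bspline_eq_eval (k i : ℕ) {ζ : ℝ} (hζ : ζ ∈ Icc (0 : ℝ) 1) :
    bspline τ k i ζ = (bsplinePoly N τ k i).eval ζ := by
  induction k generalizing i with
  | zero =>
    rw [bspline, bsplinePoly]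
    rcases lt_trichotomy i N with hi | rfl | hi
    · have : τ (i + 1) ≤ 0 := h0 ▸ hτ (by omega)
      rw [if_neg, if_neg hi.ne, Polynomial.eval_zero]
      rintro (⟨-, -, h⟩ | ⟨h, -, h'⟩) <;> linarith [hζ.1]
    · rw [if_pos, if_pos rfl, Polynomial.eval_one]
      rw [h0, h1]
      rcases hζ.2.lt_or_eq with h | h
      · exact Or.inl ⟨h, hζ.1, h⟩
      · exact Or.inr ⟨h.ge, h ▸ zero_lt_one, h.le⟩
    · have : 1 ≤ τ i := h1 ▸ hτ (by omega)
      rw [if_neg, if_neg hi.ne', Polynomial.eval_zero]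
      rintro (⟨h, h', -⟩ | ⟨-, h, -⟩) <;> linarith [hζ.2]
  | succ k ih => rw [bspline, eval_bsplinePoly_succ, ih, ih]

lemma knot_sub_pos {i j : ℕ} (hi : i ≤ N) (hj : N + 1 ≤ j) : 0 < τ j - τ i := by
  have := hτ hi
  have := hτ hj
  linarith

lemma bsplinePoly_pos {k i : ℕ} (hi : i ≤ N) (hk : N ≤ i + k) {ζ : ℝ} (hζ : ζ ∈ Ioo (0 : ℝ) 1) :
    0 < (bsplinePoly N τ k i).eval ζ := by
  induction k generalizing i with
  | zero => rw [bsplinePoly, if_pos (by omega)]; simp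
  | succ k ih =>
    rw [eval_bsplinePoly_succ]
    have ha : 0 < ζ - τ i := by linarith [hτ hi, hζ.1]
    have hb : 0 < τ (i + k + 2) - ζ := by
      linarith [hτ (show N + 1 ≤ i + k + 2 by omega), hζ.2]
    have hleft : N ≤ i + k →
        0 < (ζ - τ i) / (τ (i + k + 1) - τ i) * (bsplinePoly N τ k i).eval ζ := fun h =>
      mul_pos (div_pos ha (knot_sub_pos hτ h0 h1 hi (by omega))) (ih hi h)
    have hright : i < N → 0 < (τ (i + k + 2) - ζ) / (τ (i + k + 2) - τ (i + 1)) *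
        (bsplinePoly N τ k (i + 1)).eval ζ := fun h =>
      mul_pos (div_pos hb (knot_sub_pos hτ h0 h1 h (by omega))) (ih h (by omega))
    rcases hi.lt_or_eq with h | h
    · by_cases h' : N ≤ i + k
      · exact add_pos (hleft h') (hright h)
      · rw [bsplinePoly_eq_zero (i := i) (by omega), Polynomial.eval_zero, mul_zero, zero_add]
        exact hright h
    · rw [bsplinePoly_eq_zero (i := i + 1) (by omega), Polynomial.eval_zero, mul_zero, add_zero]
      exact hleft (by omega)

lemma unitIntegral_bsplinePoly_pos {i : ℕ} (hi : i ≤ N) :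
    0 < unitIntegral (bsplinePoly N τ N i) := by
  rw [← integral_eval_unit]
  exact intervalIntegral.intervalIntegral_pos_of_pos_on
    ((bsplinePoly N τ N i).continuous.intervalIntegrable _ _)
    (fun ζ hζ => bsplinePoly_pos hτ h0 h1 hi (by omega) hζ) zero_lt_one

/-- Marsden's identity. -/
lemma marsden {k : ℕ} (hk : k ≤ N) (x y : ℝ) :
    ∑ i ∈ Finset.range (N + 1),
      (∏ j ∈ Finset.range k, (τ (i + 1 + j) - y)) * (bsplinePoly N τ k i).eval x =
        (x - y) ^ k := by
  induction k with
  | zero =>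
    simp only [Finset.range_zero, Finset.prod_empty, one_mul, pow_zero, bsplinePoly]
    rw [Finset.sum_eq_single N] <;> simp +contextual
  | succ k ih =>
    have hz : (bsplinePoly N τ k 0).eval x = 0 := by
      rw [bsplinePoly_eq_zero (by omega), Polynomial.eval_zero]
    have hz' : (bsplinePoly N τ k (N + 1)).eval x = 0 := by
      rw [bsplinePoly_eq_zero (by omega), Polynomial.eval_zero]
    -- Both sums are reindexed by the degree `k` B-spline `i + 1`; the B-splines `0` and `N + 1`
    -- vanish on `[0,1]`. The coefficients then agree because linear interpolation between the knots
    -- `i + 1` and `i + k + 2` reproduces `x - y`.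
    rw [pow_succ, ← ih (by omega), Finset.sum_range_succ' (n := N) (f := fun i =>
      (∏ j ∈ Finset.range k, (τ (i + 1 + j) - y)) * (bsplinePoly N τ k i).eval x), hz, mul_zero,
      add_zero, Finset.sum_mul]
    simp only [eval_bsplinePoly_succ, mul_add, Finset.sum_add_distrib]
    rw [Finset.sum_range_succ' (n := N), hz, mul_zero, mul_zero, add_zero,
      Finset.sum_range_succ (n := N), hz', mul_zero, mul_zero, add_zero, ← Finset.sum_add_distrib]
    refine Finset.sum_congr rfl fun i hi => ?_
    have hi := Finset.mem_range.1 hi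
    by_cases h : N ≤ i + 1 + k
    · have hd := (knot_sub_pos hτ h0 h1 (show i + 1 ≤ N by omega)
        (show N + 1 ≤ i + k + 2 by omega)).ne'
      rw [Finset.prod_range_succ, Finset.prod_range_succ' (f := fun j => τ (i + 1 + j) - y)]
      have e1 : i + 1 + k + 1 = i + k + 2 := by ring
      have e2 : i + 1 + 1 + k = i + k + 2 := by ring
      have e3 : ∏ j ∈ Finset.range k, (τ (i + 1 + (j + 1)) - y) =
          ∏ j ∈ Finset.range k, (τ (i + 1 + 1 + j) - y) :=
        Finset.prod_congr rfl fun j _ => by rw [add_assoc (i + 1) 1 j, add_comm 1 j]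
      rw [e1, e2, e3, add_zero]
      field_simp
      ring
    · rw [bsplinePoly_eq_zero (by omega)]
      simp

lemma X_sub_C_pow_mem_span_bsplinePoly (y : ℝ) :
    (Polynomial.X - Polynomial.C y) ^ N ∈
      Submodule.span ℝ (range fun i : Fin (N + 1) => bsplinePoly N τ N i) := by
  rw [Submodule.mem_span_range_iff_exists_fun]
  refine ⟨fun i => ∏ j ∈ Finset.range N, (τ (i + 1 + j) - y), Polynomial.funext fun x => ?_⟩
  have := marsden hτ h0 h1 le_rfl x y
  rw [Finset.sum_range] at this
  simpa [Polynomial.eval_finsetSum] using this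

/-- A functional `f` annihilating the span annihilates every `(X - y)^N`. This is a polynomial in
`y` with coefficients `± N.choose m * f (X ^ m)`, so `f` annihilates each `X ^ m`. -/
lemma X_pow_mem_span_bsplinePoly {j : ℕ} (hj : j ≤ N) :
    (Polynomial.X : ℝ[X]) ^ j ∈
      Submodule.span ℝ (range fun i : Fin (N + 1) => bsplinePoly N τ N i) := by
  by_contra hX
  obtain ⟨f, hf, hS⟩ := Submodule.exists_le_ker_of_notMem hX
  let r : ℝ[X] := ∑ m ∈ Finset.range (N + 1),
    Polynomial.monomial (N - m) (f (Polynomial.X ^ m) * ((-1) ^ (N - m) * N.choose m))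
  have hr : r = 0 := Polynomial.funext fun y => by
    have h : f ((Polynomial.X - Polynomial.C y) ^ N) = 0 :=
      hS (X_sub_C_pow_mem_span_bsplinePoly hτ h0 h1 y)
    rw [sub_eq_add_neg, add_pow, map_sum] at h
    rw [Polynomial.eval_zero, ← h, Polynomial.eval_finsetSum]
    refine Finset.sum_congr rfl fun m _ => ?_
    have : Polynomial.X ^ m * (-Polynomial.C y) ^ (N - m) * (N.choose m : ℝ[X]) =
        ((-y) ^ (N - m) * N.choose m) • Polynomial.X ^ m := by
      rw [Polynomial.smul_eq_C_mul]
      simp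
      ring
    rw [this, map_smul, Polynomial.eval_monomial, smul_eq_mul, neg_pow y]
    ring
  have hc : r.coeff (N - j) = f (Polynomial.X ^ j) * ((-1) ^ (N - j) * N.choose j) := by
    rw [Polynomial.finsetSum_coeff, Finset.sum_eq_single j]
    · simp
    · intro m hm hmj
      rw [Polynomial.coeff_monomial, if_neg]
      have := Finset.mem_range.1 hm
      omega
    · intro h
      exact absurd (Finset.mem_range.2 (by omega)) h
  rw [hr, Polynomial.coeff_zero, eq_comm, mul_eq_zero] at hc
  rcases hc with hc | hc
  · exact hf hc
  · have := (Nat.choose_pos hj).ne'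
    simp [this] at hc

/-- `N + 1` vectors whose span has dimension at least `N + 1` are independent. -/
lemma linearIndependent_bsplinePoly :
    LinearIndependent ℝ fun i : Fin (N + 1) => bsplinePoly N τ N i := by
  rw [linearIndependent_iff_card_le_finrank_span, Fintype.card_fin]
  have hle : Polynomial.degreeLT ℝ (N + 1) ≤
      Submodule.span ℝ (range fun i : Fin (N + 1) => bsplinePoly N τ N i) := by
    rw [Polynomial.degreeLT_eq_span_X_pow, Submodule.span_le]
    intro p hp
    obtain ⟨j, hj, rfl⟩ := Finset.mem_image.1 (Finset.mem_coe.1 hp)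
    exact X_pow_mem_span_bsplinePoly hτ h0 h1 (by have := Finset.mem_range.1 hj; omega)
  have : Module.Finite ℝ (Submodule.span ℝ (range fun i : Fin (N + 1) => bsplinePoly N τ N i)) :=
    FiniteDimensional.span_of_finite ℝ (finite_range _)
  simpa [finrank_degreeLT, Set.finrank] using Submodule.finrank_mono hle

lemma isZeroMeanSplineBasis_constrainedSpline {c : Fin N → ℝ} (hc : ∀ i, c i ≠ 0) :
    IsZeroMeanSplineBasis N fun i ζ => c i * constrainedSpline τ N i ζ := by
  set b : Fin (N + 1) → ℝ[X] := fun i => bsplinePoly N τ N i with hb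
  set p : Fin N → ℝ[X] := fun i =>
    c i • (b i.castSucc + constraintFactor τ N i • b i.succ) with hp
  have heq : ∀ i : Fin N, ∀ ζ ∈ Icc (0 : ℝ) 1,
      c i * constrainedSpline τ N i ζ = (p i).eval ζ := fun i ζ hζ => by
    simp [hp, hb, constrainedSpline, bspline_eq_eval hτ h0 h1 _ _ hζ, mul_add]
  have hint : ∀ i, ∫ ζ in (0 : ℝ)..1, bspline τ N i ζ = unitIntegral (bsplinePoly N τ N i) :=
    fun i => by
      rw [← integral_eval_unit]
      refine intervalIntegral.integral_congr fun ζ hζ => ?_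
      rw [uIcc_of_le zero_le_one] at hζ
      exact bspline_eq_eval hτ h0 h1 _ _ hζ
  have hdeg : ∀ i, (p i).natDegree ≤ N := fun i =>
    (Polynomial.natDegree_smul_le _ _).trans (Polynomial.natDegree_add_le_of_degree_le
      (natDegree_bsplinePoly_le _ _)
      ((Polynomial.natDegree_smul_le _ _).trans (natDegree_bsplinePoly_le _ _)))
  refine ⟨fun i => ⟨fun a d ha _ hd _ => ⟨p i, hdeg i, fun ζ hζ =>
    heq i ζ ⟨ha.trans hζ.1, hζ.2.trans hd⟩⟩, ?_⟩, fun i => ?_, ?_⟩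
  · have hcd : ContDiff ℝ ((N - 1 : ℕ) : ℕ∞) fun ζ => (p i).eval ζ := by
      simpa using (p i).contDiff_aeval (𝕜 := ℝ) _
    exact hcd.contDiffOn.congr (heq i)
  -- Positivity of the integral of `b_{i+1}` makes the quotient `μ_i` a genuine one, so the means
  -- cancel.
  · have hpos := (unitIntegral_bsplinePoly_pos hτ h0 h1 (show (i : ℕ) + 1 ≤ N from i.2)).ne'
    have : ∫ ζ in (0 : ℝ)..1, c i * constrainedSpline τ N i ζ = unitIntegral (p i) := by
      rw [← integral_eval_unit]
      refine intervalIntegral.integral_congr fun ζ hζ => ?_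
      rw [uIcc_of_le zero_le_one] at hζ
      exact heq i ζ hζ
    rw [this, hp, hb]
    simp only [map_smul, map_add, smul_eq_mul, constraintFactor, hint, Fin.val_castSucc,
      Fin.val_succ]
    field_simp
    ring
  · have hli := linearIndependent_add_smul_succ (linearIndependent_bsplinePoly hτ h0 h1) hc
      fun i => constraintFactor τ N i
    refine Fintype.linearIndependent_iff.2 fun d hd => Fintype.linearIndependent_iff.1 hli d ?_
    refine eq_of_eval_eq_on_Icc fun ζ hζ => ?_
    have := congr($hd ⟨ζ, hζ⟩)
    simp only [Finset.sum_apply, Pi.smul_apply, Set.domRestrict_apply, heq _ ζ hζ,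
      smul_eq_mul] at this
    simpa [Polynomial.eval_finsetSum, hp, hb, mul_add] using this

end BSpline

end SSWME

end

theorem mainTheorem1 (N : ℕ) [NeZero N] (g : ℝ) (hg : 0 < g) :
    -- constrained B-splines of degree `N` without interior knots are such a basis
    (∀ (τ : ℕ → ℝ) (c : Fin N → ℝ), Monotone τ → τ N = 0 → τ (N + 1) = 1 → (∀ i, c i ≠ 0) →
      SSWME.IsZeroMeanSplineBasis N (fun i ζ => c i * SSWME.constrainedSpline τ N i ζ)) ∧
    ∀ φ : Fin N → ℝ → ℝ, SSWME.IsZeroMeanSplineBasis N φ →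
      -- the change of basis
      IsUnit (SSWME.massMatrix φ) ∧
      IsUnit (SSWME.massMatrix (SSWME.legendreBasis N)) ∧
      IsUnit (SSWME.transferMatrix φ) ∧
      (∀ i, ∀ ζ ∈ Set.Icc (0 : ℝ) 1,
        SSWME.legendreBasis N i ζ = ∑ l, SSWME.transferMatrix φ i l * φ l ζ) ∧
      -- the SSWME system is a linear change of variables of the Legendre SWME
      (∀ (h u : ℝ) (s : Fin N → ℝ),
        SSWME.systemMatrix g φ h u s =
          SSWME.diagBlock (SSWME.transferMatrix φ)ᵀ *
            SSWME.systemMatrix g (SSWME.legendreBasis N) h u (SSWME.legendreCoeffs φ s) *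
            (SSWME.diagBlock (SSWME.transferMatrix φ)ᵀ)⁻¹) ∧
      (∀ (Ω : Set (ℝ × ℝ)) (h u : ℝ × ℝ → ℝ) (s : ℝ × ℝ → Fin N → ℝ), IsOpen Ω →
        (SSWME.IsSolution (SSWME.diagBlock (SSWME.massMatrix φ))
            (SSWME.advectionMatrix g φ) Ω h u s ↔
          SSWME.IsSolution (SSWME.diagBlock (SSWME.massMatrix (SSWME.legendreBasis N)))
            (SSWME.advectionMatrix g (SSWME.legendreBasis N)) Ω h u
            (fun p => SSWME.legendreCoeffs φ (s p)))) ∧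
      -- the coefficients `s̃_i = T_{1i} α₁` are those of a linear velocity profile
      (∀ α₁ : ℝ,
        SSWME.legendreCoeffs φ (SSWME.linearProfileCoeffs φ α₁) = Pi.single 0 α₁ ∧
        ∀ ζ ∈ Set.Icc (0 : ℝ) 1,
          ∑ i, SSWME.linearProfileCoeffs φ α₁ i * φ i ζ = α₁ * (1 - 2 * ζ)) ∧
      -- the regularized matrix is similar to the HSWME matrix
      (∀ (h u : ℝ) (s : Fin N → ℝ),
        SSWME.hsswmeMatrix g φ h u s =
          SSWME.diagBlock (SSWME.transferMatrix φ)ᵀ *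
            SSWME.hswmeMatrix g h u (SSWME.legendreCoeffs φ s) *
            (SSWME.diagBlock (SSWME.transferMatrix φ)ᵀ)⁻¹) ∧
      (∀ (Ω : Set (ℝ × ℝ)) (h u : ℝ × ℝ → ℝ) (s : ℝ × ℝ → Fin N → ℝ), IsOpen Ω →
        (SSWME.IsSolution 1 (SSWME.hsswmeMatrix g φ) Ω h u s ↔
          SSWME.IsSolution 1 (SSWME.hswmeMatrix g) Ω h u
            (fun p => SSWME.legendreCoeffs φ (s p)))) ∧
      -- global hyperbolicity
      (∀ (h u : ℝ) (α : Fin N → ℝ), 0 < h → SSWME.IsHyperbolic (SSWME.hswmeMatrix g h u α)) ∧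
      (∀ (h u : ℝ) (s : Fin N → ℝ), 0 < h → SSWME.IsHyperbolic (SSWME.hsswmeMatrix g φ h u s)) := by
  refine ⟨fun τ c hτ h0 h1 hc => SSWME.isZeroMeanSplineBasis_constrainedSpline hτ h0 h1 hc,
    fun φ hφ => ?_⟩
  have hL : ∀ (h u : ℝ) (α : Fin N → ℝ), 0 < h → SSWME.IsHyperbolic (SSWME.hswmeMatrix g h u α) :=
    fun h u α hh => SSWME.isHyperbolic_legendre hg hh u (α 0)
  refine ⟨hφ.isUnit_massMatrix, SSWME.isUnit_massMatrix_legendreBasis N,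
    hφ.isUnit_transferMatrix, fun i ζ hζ => hφ.legendreBasis_eq_sum i hζ, hφ.systemMatrix_eq g,
    fun Ω h u s _ => hφ.isSolution_iff g Ω h u s,
    fun α₁ => ⟨hφ.legendreCoeffs_linearProfileCoeffs α₁, fun ζ hζ =>
      hφ.sum_linearProfileCoeffs α₁ hζ⟩,
    hφ.hsswmeMatrix_eq g, fun Ω h u s _ => hφ.isSolution_hsswme_iff g Ω h u s, hL,
    fun h u s hh => ?_⟩
  rw [hφ.hsswmeMatrix_eq]
  exact (hL h u _ hh).conj (SSWME.isUnit_diagBlock hφ.isUnit_transferMatrix_transpose)
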